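/- Let $T_0=(A_0,B_0,C_0)$ be a non-degenerate triangle in the Euclidean plane, and let $\xi_a^{(n)},\xi_b^{(n)},\xi_c^{(n)}$, $n\ge 1$, be independent random variables, each uniform on $[0,1]$. Given $T_{n-1}=(A_{n-1},B_{n-1},C_{n-1})$, let $T_n=(A_n,B_n,C_n)$ be the triangle with one random vertex on each side of $T_{n-1}$: $$A_n=B_{n-1}+\xi_a^{(n)}(C_{n-1}-B_{n-1}),\quad B_n=C_{n-1}+\xi_b^{(n)}(A_{n-1}-C_{n-1}),\quad C_n=A_{n-1}+\xi_c^{(n)}(B_{n-1}-A_{n-1}).$$ Almost surely all triangles $T_n$ are non-degenerate. Let $(x_n,y_n)$ be the normalized apex of $T_n$: after relabelling its vertices, $T_n$ is similar to the triangle with vertices $A=(0,0)$, $B=(1,0)$, $C=(x_n,y_n)$ with $y_n\ge 0$ and $|AB|\ge|AC|\ge|BC|$. Then $x_n$ converges in distribution, as $n\to\infty$, to the uniform distribution on $[1/2,1]$. -/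

import Mathlib

open MeasureTheory ProbabilityTheory Filter

/-- The Euclidean plane. -/
abbrev Plane : Type := EuclideanSpace ℝ (Fin 2)

/-- The triangle `A₁B₁C₁` obtained from the triangle `T = (A, B, C)` by choosing `A₁` on `BC`,
`B₁` on `CA` and `C₁` on `AB` with `A₁ = B + t 0 • (C - B)`, `B₁ = C + t 1 • (A - C)`,
`C₁ = A + t 2 • (B - A)` (the index `i + 1` is taken modulo `3`). -/
noncomputable def subtriangle (T : Fin 3 → Plane) (t : Fin 3 → ℝ) : Fin 3 → Plane :=
  fun i => AffineMap.lineMap (T (i + 1)) (T (i + 2)) (t i)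

/-- The sequence of triangles that starts at `T₀`; the `n`-th subdivision uses the
parameters `ξ n`. -/
noncomputable def triangleSeq (T₀ : Fin 3 → Plane) (ξ : ℕ → Fin 3 → ℝ) : ℕ → Fin 3 → Plane
  | 0 => T₀
  | n + 1 => subtriangle (triangleSeq T₀ ξ n) (ξ n)

/-- The triangle with vertices `A = (0, 0)`, `B = (1, 0)`, `C = (x, y)`. -/
noncomputable def standardTriangle (x y : ℝ) : Fin 3 → Plane :=
  ![!₂[0, 0], !₂[1, 0], !₂[x, y]]

/-- `(x, y)` is the normalized apex of the triangle `T`: after a relabelling of its vertices,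
`T` is similar to the triangle `A = (0, 0)`, `B = (1, 0)`, `C = (x, y)`, where `C` lies in
the closed upper half-plane, `|AB| ≥ |AC| ≥ |BC|`. -/
def IsNormalizedApex (T : Fin 3 → Plane) (x y : ℝ) : Prop :=
  0 ≤ y ∧
  dist (standardTriangle x y 0) (standardTriangle x y 2) ≤
    dist (standardTriangle x y 0) (standardTriangle x y 1) ∧
  dist (standardTriangle x y 1) (standardTriangle x y 2) ≤
    dist (standardTriangle x y 0) (standardTriangle x y 2) ∧
  ∃ σ : Equiv.Perm (Fin 3), Similar (T ∘ σ) (standardTriangle x y)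

open Classical in
/-- The horizontal coordinate `x` of the normalized apex `(x, y)` of a triangle (with the
value `0` if all three vertices coincide, the only case without a normalized apex). -/
noncomputable def normalizedX (T : Fin 3 → Plane) : ℝ :=
  if h : ∃ x y, IsNormalizedApex T x y then h.choose else 0

lemma dist_standardTriangle (x y : ℝ) :
    dist (standardTriangle x y 0) (standardTriangle x y 1) = 1 ∧
    dist (standardTriangle x y 0) (standardTriangle x y 2) = √(x ^ 2 + y ^ 2) ∧
    dist (standardTriangle x y 1) (standardTriangle x y 2) = √((1 - x) ^ 2 + y ^ 2) := by
  refine ⟨?_, ?_, ?_⟩ <;>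
    simp [standardTriangle, EuclideanSpace.dist_eq, Fin.sum_univ_two, Real.dist_eq]

/-- The normalized apex exists unless all three vertices coincide. -/
lemma exists_isNormalizedApex {T : Fin 3 → Plane} (hT : ∃ i j, T i ≠ T j) :
    ∃ x y, IsNormalizedApex T x y := by
  obtain ⟨σ, h1, h2⟩ : ∃ σ : Equiv.Perm (Fin 3),
      dist (T (σ 0)) (T (σ 2)) ≤ dist (T (σ 0)) (T (σ 1)) ∧
      dist (T (σ 1)) (T (σ 2)) ≤ dist (T (σ 0)) (T (σ 2)) := by
    have key : ∀ i j k : Fin 3, i ≠ j → i ≠ k → j ≠ k →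
        dist (T i) (T k) ≤ dist (T i) (T j) → dist (T j) (T k) ≤ dist (T i) (T k) →
        ∃ σ : Equiv.Perm (Fin 3),
          dist (T (σ 0)) (T (σ 2)) ≤ dist (T (σ 0)) (T (σ 1)) ∧
          dist (T (σ 1)) (T (σ 2)) ≤ dist (T (σ 0)) (T (σ 2)) := by
      intro i j k hij hik hjk h1 h2
      have hinj : Function.Injective ![i, j, k] := by
        intro a b
        fin_cases a <;> fin_cases b <;> simp [hij, hik, hjk, hij.symm, hik.symm, hjk.symm]
      refine ⟨Equiv.ofBijective _ (Finite.injective_iff_bijective.mp hinj), ?_, ?_⟩ <;>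
        simpa using by assumption
    have c01 := dist_comm (T 0) (T 1)
    have c02 := dist_comm (T 0) (T 2)
    have c12 := dist_comm (T 1) (T 2)
    by_cases a : dist (T 0) (T 1) ≤ dist (T 0) (T 2) <;>
    by_cases b : dist (T 0) (T 1) ≤ dist (T 1) (T 2) <;>
    by_cases c : dist (T 0) (T 2) ≤ dist (T 1) (T 2) <;>
    first
    | exact key 0 1 2 (by decide) (by decide) (by decide) (by linarith) (by linarith)
    | exact key 1 0 2 (by decide) (by decide) (by decide) (by linarith) (by linarith)
    | exact key 0 2 1 (by decide) (by decide) (by decide) (by linarith) (by linarith)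
    | exact key 2 0 1 (by decide) (by decide) (by decide) (by linarith) (by linarith)
    | exact key 1 2 0 (by decide) (by decide) (by decide) (by linarith) (by linarith)
    | exact key 2 1 0 (by decide) (by decide) (by decide) (by linarith) (by linarith)
  set L := dist (T (σ 0)) (T (σ 1)) with hL
  set m := dist (T (σ 0)) (T (σ 2)) with hm
  set s := dist (T (σ 1)) (T (σ 2)) with hs
  have hs0 : 0 ≤ s := dist_nonneg
  have hLpos : 0 < L := by
    by_contra hneg
    have hL0 : L = 0 := le_antisymm (not_lt.mp hneg) dist_nonneg
    have e1 : T (σ 0) = T (σ 1) := dist_eq_zero.mp hL0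
    have e2 : T (σ 0) = T (σ 2) := dist_eq_zero.mp (by rw [← hm]; linarith)
    obtain ⟨i, j, hij⟩ := hT
    have all : ∀ a, T (σ a) = T (σ 0) := by
      intro a
      fin_cases a
      · rfl
      · exact e1.symm
      · exact e2.symm
    exact hij (by
      rw [← σ.apply_symm_apply i, ← σ.apply_symm_apply j, all (σ.symm i), all (σ.symm j)])
  have htri : L ≤ m + s := by
    rw [hL, hm, hs, dist_comm (T (σ 1))]
    exact dist_triangle _ _ _
  have hm0 : 0 ≤ m := hs0.trans h2
  set x := (L ^ 2 + m ^ 2 - s ^ 2) / (2 * L ^ 2) with hx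
  have hx0 : 0 ≤ x := by
    apply div_nonneg _ (by positivity)
    nlinarith
  have hxm : x ≤ m / L := by
    rw [hx, div_le_div_iff₀ (by positivity) hLpos]
    have : L ^ 2 + m ^ 2 - s ^ 2 ≤ 2 * L * m := by nlinarith
    nlinarith
  have hy : 0 ≤ (m / L) ^ 2 - x ^ 2 := by nlinarith
  have hd1 : √(x ^ 2 + √((m / L) ^ 2 - x ^ 2) ^ 2) = m / L := by
    rw [Real.sq_sqrt hy, add_sub_cancel, Real.sqrt_sq (by positivity)]
  have hd2 : √((1 - x) ^ 2 + √((m / L) ^ 2 - x ^ 2) ^ 2) = s / L := by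
    have hx2 : 2 * x = 1 + (m / L) ^ 2 - (s / L) ^ 2 := by
      rw [hx]
      field_simp
    have hsq : (1 - x) ^ 2 + ((m / L) ^ 2 - x ^ 2) = (s / L) ^ 2 := by linear_combination -hx2
    rw [Real.sq_sqrt hy, hsq, Real.sqrt_sq (by positivity)]
  obtain ⟨d01, d02, d12⟩ := dist_standardTriangle x (√((m / L) ^ 2 - x ^ 2))
  rw [hd1] at d02
  rw [hd2] at d12
  refine ⟨x, √((m / L) ^ 2 - x ^ 2), Real.sqrt_nonneg _, ?_, ?_, σ, ?_⟩
  · rw [d01, d02]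
    exact (div_le_one hLpos).mpr h1
  · rw [d12, d02]
    gcongr
  · rw [similar_iff_exists_dist_eq]
    refine ⟨⟨L, hLpos.le⟩, fun h => hLpos.ne' (congrArg NNReal.toReal h), ?_⟩
    have r01 : L = L * 1 := by ring
    have r02 : m = L * (m / L) := by field_simp
    have r12 : s = L * (s / L) := by field_simp
    rw [← d01] at r01
    rw [← d02] at r02
    rw [← d12] at r12
    intro i j
    fin_cases i <;> fin_cases j
    · exact (dist_self _).trans (by rw [dist_self, mul_zero])
    · exact r01
    · exact r02
    · exact (dist_comm _ _).trans (r01.trans (by rw [dist_comm]; rfl))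
    · exact (dist_self _).trans (by rw [dist_self, mul_zero])
    · exact r12
    · exact (dist_comm _ _).trans (r02.trans (by rw [dist_comm]; rfl))
    · exact (dist_comm _ _).trans (r12.trans (by rw [dist_comm]; rfl))
    · exact (dist_self _).trans (by rw [dist_self, mul_zero])

/-- The horizontal coordinate of the normalized apex in terms of the side lengths of the
triangle; in particular, it is unique. -/
lemma IsNormalizedApex.x_eq {T : Fin 3 → Plane} {x y : ℝ} (h : IsNormalizedApex T x y) :
    x = (dist (T 1) (T 2) ^ 2 + dist (T 2) (T 0) ^ 2 + dist (T 0) (T 1) ^ 2 -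
        2 * min (dist (T 1) (T 2)) (min (dist (T 2) (T 0)) (dist (T 0) (T 1))) ^ 2) /
      (2 * max (dist (T 1) (T 2)) (max (dist (T 2) (T 0)) (dist (T 0) (T 1))) ^ 2) := by
  obtain ⟨-, h1, h2, σ, hσ⟩ := h
  obtain ⟨r, hr, hd⟩ := similar_iff_exists_dist_eq.mp hσ
  obtain ⟨d01, d02, d12⟩ := dist_standardTriangle x y
  have e01 := hd 0 1
  have e02 := hd 0 2
  have e12 := hd 1 2
  have hrpos : (0 : ℝ) < r := by positivity
  rw [d01, d02] at h1
  rw [d02, d12] at h2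
  rw [d01] at e01
  rw [d02] at e02
  rw [d12] at e12
  have q1 : √(x ^ 2 + y ^ 2) ^ 2 = x ^ 2 + y ^ 2 := Real.sq_sqrt (by positivity)
  have q2 : √((1 - x) ^ 2 + y ^ 2) ^ 2 = (1 - x) ^ 2 + y ^ 2 := Real.sq_sqrt (by positivity)
  set u := √(x ^ 2 + y ^ 2)
  set v := √((1 - x) ^ 2 + y ^ 2)
  have hxuv : x = (1 + u ^ 2 - v ^ 2) / 2 := by rw [q1, q2]; ring
  simp only [Function.comp_apply] at e01 e02 e12
  have i1 : (r : ℝ) * v ≤ r * u := by gcongr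
  have i2 : (r : ℝ) * u ≤ r * 1 := by gcongr
  have i3 : (r : ℝ) * v ≤ r * 1 := i1.trans i2
  have f01 := e01
  have f02 := e02
  have f12 := e12
  rw [dist_comm] at f01 f02 f12
  have n01 : σ 0 ≠ σ 1 := by simp
  have n02 : σ 0 ≠ σ 2 := by simp
  have n12 : σ 1 ≠ σ 2 := by simp
  generalize σ 0 = a at *
  generalize σ 1 = b at *
  generalize σ 2 = c at *
  rw [hxuv]
  fin_cases a <;> fin_cases b <;> fin_cases c <;> first
    | exact absurd rfl n01
    | exact absurd rfl n02
    | exact absurd rfl n12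
    | (simp only [Fin.zero_eta, Fin.mk_one, Fin.reduceFinMk] at e01 e02 e12 f01 f02 f12
       simp only [e01, e02, e12, f01, f02, f12, i1, i2, i3, min_eq_left, min_eq_right,
         max_eq_left, max_eq_right]
       field_simp
       ring)

/-- `normalizedX T` is the horizontal coordinate of every normalized apex of `T`. -/
lemma IsNormalizedApex.normalizedX_eq {T : Fin 3 → Plane} {x y : ℝ}
    (h : IsNormalizedApex T x y) : normalizedX T = x := by
  have hex : ∃ x y, IsNormalizedApex T x y := ⟨x, y, h⟩
  rw [normalizedX, dif_pos hex]
  obtain ⟨y', hy'⟩ := hex.choose_spec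
  rw [hy'.x_eq, h.x_eq]

/-! The proof projects everything to the horizontal axis. Choosing a point on a side commutes with
the projection, so the projected vertices follow the same subdivision process on a line
(`subtriangle_coord_zero`), and two facts about that process suffice.

First, the shape of a projected triple is exactly stationary after one step. Up to relabelling and
an affine map the triple is `0 ≤ x ≤ 1`, and the new points are uniform on `[0, x]`, `[x, 1]` and
`[0, 1]`. Fix the two extreme new points, which lie on either side of `x`. If the middle point is
the one drawn from `[0, 1]`, it ranges over the whole segment between them; if it is drawn from `[0,
x]` or `[x, 1]`, it ranges over the part of that segment on one side of `x`. These two parts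
together make up the segment once more, so the middle point divides it in a uniform ratio `s`,
whatever `x` is. The normalized apex of the flat triple is `max s (1 - s)`, which is uniform on
`[1/2, 1]` (`lintegral_flatX_flatSub`, `map_max_one_sub_unitUniform`).

Second, the triangles become flat. The area is multiplied by a factor that depends only on the
parameters, and the scale-invariant quantity `√area / width of the projection` shrinks on average by
the factor `31/32` at every step (`lintegral_flatness_subtriangle_le`). By Markov's inequality it
tends to `0` in probability. A triangle with small flatness has nearly the apex of its projection
(`abs_normalizedX_sub_flatX_le`), so `normalizedX - flatX` tends to `0` in probability, and
Slutsky's theorem gives the limit law. -/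

/-! ### Integration over the unit interval -/

/-- The uniform distribution on `[0, 1]`. -/
noncomputable abbrev unitUniform : Measure ℝ := volume.restrict (Set.Icc (0 : ℝ) 1)

instance : IsProbabilityMeasure unitUniform := ⟨by simp [unitUniform]⟩

lemma ae_unitUniform_mem_Ioo : ∀ᵐ a ∂unitUniform, a ∈ Set.Ioo (0 : ℝ) 1 := by
  rw [unitUniform, ← restrict_Ioo_eq_restrict_Icc]
  exact ae_restrict_mem measurableSet_Ioo

lemma measurePreserving_one_sub_unitUniform :
    MeasurePreserving (fun a : ℝ => 1 - a) unitUniform unitUniform := by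
  have h := (Measure.measurePreserving_sub_left (volume : Measure ℝ) 1).restrict_preimage
    (s := Set.Icc (0 : ℝ) 1) measurableSet_Icc
  have e : (fun a : ℝ => 1 - a) ⁻¹' Set.Icc (0 : ℝ) 1 = Set.Icc 0 1 := by
    ext a
    simp only [Set.mem_preimage, Set.mem_Icc]
    constructor <;> rintro ⟨h1, h2⟩ <;> constructor <;> linarith
  rwa [e] at h

lemma lintegral_Icc_affine {u v : ℝ} (h : u ≤ v) (f : ℝ → ENNReal) :
    ∫⁻ c in Set.Icc u v, f c =
      ENNReal.ofReal (v - u) * ∫⁻ s, f (u + s * (v - u)) ∂unitUniform := by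
  rcases h.eq_or_lt with rfl | h
  · simp
  have himg : (fun s : ℝ => u + s * (v - u)) '' Set.Icc 0 1 = Set.Icc u v := by
    ext c
    simp only [Set.mem_image, Set.mem_Icc]
    constructor
    · rintro ⟨s, ⟨h0, h1⟩, rfl⟩
      constructor <;> nlinarith
    · rintro ⟨h0, h1⟩
      have hp : 0 < v - u := by linarith
      refine ⟨(c - u) / (v - u), ⟨div_nonneg (by linarith) hp.le, ?_⟩, ?_⟩
      · rw [div_le_one hp]; linarith
      · field_simp; ring
  have hder : ∀ s ∈ Set.Icc (0 : ℝ) 1,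
      HasDerivWithinAt (fun s : ℝ => u + s * (v - u)) (v - u) (Set.Icc 0 1) s := by
    intro s _
    have := ((hasDerivAt_id s).mul_const (v - u)).const_add u
    simpa using this.hasDerivWithinAt
  have hinj : Set.InjOn (fun s : ℝ => u + s * (v - u)) (Set.Icc 0 1) := by
    intro s _ t _ hst
    have hp : v - u ≠ 0 := by linarith
    simpa [hp] using hst
  rw [← himg, lintegral_image_eq_lintegral_abs_deriv_mul measurableSet_Icc hder hinj,
    lintegral_const_mul' _ _ (by simp), abs_of_pos (by linarith)]

lemma lintegral_Icc_split {u v w : ℝ} (h₁ : u ≤ v) (h₂ : v ≤ w) (f : ℝ → ENNReal) :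
    ∫⁻ c in Set.Icc u w, f c = (∫⁻ c in Set.Icc u v, f c) + ∫⁻ c in Set.Icc v w, f c := by
  rw [← Set.Icc_union_Ioc_eq_Icc h₁ h₂, lintegral_union measurableSet_Ioc]
  · rw [restrict_Ioc_eq_restrict_Icc]
  · rw [Set.disjoint_left]
    intro a ha hb
    exact absurd ha.2 (not_le.mpr hb.1)

/-! ### Sorting three random points -/

/-- Fubini's theorem on the triangle `0 ≤ c ≤ a ≤ 1`, in unit coordinates. -/
lemma lintegral_triangle_swap {g : ℝ → ℝ → ENNReal} (hg : Measurable (Function.uncurry g)) :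
    ∫⁻ a, ENNReal.ofReal a * ∫⁻ s, g a (a * s) ∂unitUniform ∂unitUniform =
      ∫⁻ c, ENNReal.ofReal (1 - c) * ∫⁻ s, g (c + (1 - c) * s) c ∂unitUniform ∂unitUniform := by
  have h1 : ∀ a ∈ Set.Icc (0 : ℝ) 1, ENNReal.ofReal a * ∫⁻ s, g a (a * s) ∂unitUniform =
      ∫⁻ c, Set.indicator {z : ℝ × ℝ | z.2 ≤ z.1} (Function.uncurry g) (a, c) ∂unitUniform := by
    intro a ha
    have := lintegral_Icc_affine ha.1 (g a)
    simp only [sub_zero, zero_add] at this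
    simp only [mul_comm a, ← this]
    have e : ∀ c, Set.indicator {z : ℝ × ℝ | z.2 ≤ z.1} (Function.uncurry g) (a, c) =
        Set.indicator (Set.Iic a) (g a) c := by
      intro c; by_cases h : c ≤ a <;> simp [Set.indicator, h]
    simp only [e]
    rw [lintegral_indicator measurableSet_Iic, Measure.restrict_restrict measurableSet_Iic]
    congr 2
    ext c
    simp only [Set.mem_Icc, Set.mem_inter_iff, Set.mem_Iic]
    constructor
    · rintro ⟨h, h'⟩; exact ⟨h', h, h'.trans ha.2⟩
    · rintro ⟨h, h', _⟩; exact ⟨h', h⟩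
  have h2 : ∀ c ∈ Set.Icc (0 : ℝ) 1,
      ENNReal.ofReal (1 - c) * ∫⁻ s, g (c + (1 - c) * s) c ∂unitUniform =
      ∫⁻ a, Set.indicator {z : ℝ × ℝ | z.2 ≤ z.1} (Function.uncurry g) (a, c) ∂unitUniform := by
    intro c hc
    have := lintegral_Icc_affine hc.2 (fun a => g a c)
    simp only [mul_comm (1 - c), ← this]
    have e : ∀ a, Set.indicator {z : ℝ × ℝ | z.2 ≤ z.1} (Function.uncurry g) (a, c) =
        Set.indicator (Set.Ici c) (fun a => g a c) a := by
      intro a; by_cases h : c ≤ a <;> simp [Set.indicator, h]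
    simp only [e]
    rw [lintegral_indicator measurableSet_Ici, Measure.restrict_restrict measurableSet_Ici]
    congr 2
    ext a
    simp only [Set.mem_Icc, Set.mem_inter_iff, Set.mem_Ici]
    constructor
    · rintro ⟨h, h'⟩; exact ⟨h, hc.1.trans h, h'⟩
    · rintro ⟨h, h', h''⟩; exact ⟨h, h''⟩
  rw [unitUniform, setLIntegral_congr_fun measurableSet_Icc h1,
    setLIntegral_congr_fun measurableSet_Icc h2, lintegral_lintegral_swap]
  exact (hg.indicator (measurableSet_le measurable_snd measurable_fst)).aemeasurable

lemma lintegral_triangle_swap' {g : ℝ → ℝ → ENNReal} (hg : Measurable (Function.uncurry g)) :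
    ∫⁻ b, ENNReal.ofReal (1 - b) * ∫⁻ s, g b (b + (1 - b) * s) ∂unitUniform ∂unitUniform =
      ∫⁻ c, ENNReal.ofReal c * ∫⁻ s, g (c * s) c ∂unitUniform ∂unitUniform :=
  (lintegral_triangle_swap (g := fun a c => g c a) (hg.comp measurable_swap)).symm

lemma Measurable.uncurry₃_comp {Φ : ℝ → ℝ → ℝ → ENNReal}
    (hΦ : Measurable fun z : ℝ × ℝ × ℝ => Φ z.1 z.2.1 z.2.2) {α : Type*} [MeasurableSpace α]
    {f g h : α → ℝ} (hf : Measurable f) (hg : Measurable g) (hh : Measurable h) :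
    Measurable fun z => Φ (f z) (g z) (h z) :=
  hΦ.comp (hf.prodMk (hg.prodMk hh))

lemma lintegral_lintegral_swap_of_measurable {F : ℝ × ℝ → ENNReal} (hF : Measurable F) :
    ∫⁻ a, ∫⁻ b, F (a, b) ∂unitUniform ∂unitUniform =
      ∫⁻ b, ∫⁻ a, F (a, b) ∂unitUniform ∂unitUniform :=
  lintegral_lintegral_swap (f := fun a b => F (a, b)) hF.aemeasurable

lemma lintegral_lintegral_add₃ {F G : ℝ × ℝ → ENNReal} (hF : Measurable F) (hG : Measurable G)
    (H : ℝ × ℝ → ENNReal) :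
    ∫⁻ a, ∫⁻ b, (F (a, b) + G (a, b) + H (a, b)) ∂unitUniform ∂unitUniform =
      ∫⁻ a, ∫⁻ b, F (a, b) ∂unitUniform ∂unitUniform +
      ∫⁻ a, ∫⁻ b, G (a, b) ∂unitUniform ∂unitUniform +
      ∫⁻ a, ∫⁻ b, H (a, b) ∂unitUniform ∂unitUniform := by
  rw [← lintegral_add_left hF.lintegral_prod_right', ← lintegral_add_left]
  · refine lintegral_congr fun a => ?_
    rw [← lintegral_add_left (f := fun b => F (a, b)) (hF.comp measurable_prodMk_left),
      ← lintegral_add_left]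
    exact (hF.comp measurable_prodMk_left).add (hG.comp measurable_prodMk_left)
  · exact hF.lintegral_prod_right'.add hG.lintegral_prod_right'

/-- Let `a`, `b`, `c` be independent and uniform on `[0, 1]`. The points `x a ≤ x + (1 - x) b`
and `c` are sorted; the integral over the middle one of the three is carried out first. -/
lemma lintegral_sorted {x : ℝ} (hx : x ∈ Set.Icc (0 : ℝ) 1) {Φ : ℝ → ℝ → ℝ → ENNReal}
    (hΦ : Measurable fun z : ℝ × ℝ × ℝ => Φ z.1 z.2.1 z.2.2) :
    ∫⁻ a, ∫⁻ b, ∫⁻ c, Φ a b c ∂unitUniform ∂unitUniform ∂unitUniform =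
      ∫⁻ a, ∫⁻ b,
        (ENNReal.ofReal (x * (1 - a) + (1 - x) * b) *
            ∫⁻ s, Φ a b (x * a + s * (x * (1 - a) + (1 - x) * b)) ∂unitUniform +
          ENNReal.ofReal (x * (1 - a)) *
            ∫⁻ s, Φ (a + (1 - a) * s) b (x * a) ∂unitUniform +
          ENNReal.ofReal ((1 - x) * b) *
            ∫⁻ s, Φ a (b * s) (x + (1 - x) * b) ∂unitUniform) ∂unitUniform ∂unitUniform := by
  obtain ⟨hx0, hx1⟩ := hx
  have hy0 : 0 ≤ 1 - x := by linarith
  -- The three terms are the positions of `c`: between the other two points, below `x * a`, and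
  -- above `x + (1 - x) * b`.
  have split : ∀ a ∈ Set.Icc (0 : ℝ) 1, ∀ b ∈ Set.Icc (0 : ℝ) 1,
      ∫⁻ c, Φ a b c ∂unitUniform =
        ENNReal.ofReal (x * (1 - a) + (1 - x) * b) *
            ∫⁻ s, Φ a b (x * a + s * (x * (1 - a) + (1 - x) * b)) ∂unitUniform +
          ENNReal.ofReal x * (ENNReal.ofReal a *
            ∫⁻ s, Φ a b (x * (a * s)) ∂unitUniform) +
          ENNReal.ofReal (1 - x) * (ENNReal.ofReal (1 - b) *
            ∫⁻ s, Φ a b (x + (1 - x) * (b + (1 - b) * s)) ∂unitUniform) := by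
    intro a ha b hb
    have i1 : 0 ≤ x * a := mul_nonneg hx0 ha.1
    have i2 : x * a ≤ x + (1 - x) * b := by
      nlinarith [mul_nonneg hx0 (sub_nonneg.2 ha.2), mul_nonneg hy0 hb.1]
    have i3 : x + (1 - x) * b ≤ 1 := by nlinarith [mul_nonneg hy0 (sub_nonneg.2 hb.2)]
    rw [show ∫⁻ c, Φ a b c ∂unitUniform = ∫⁻ c in Set.Icc 0 1, Φ a b c from rfl,
      lintegral_Icc_split i1 (i2.trans i3), lintegral_Icc_split i2 i3, lintegral_Icc_affine i1,
      lintegral_Icc_affine i2, lintegral_Icc_affine i3, ← mul_assoc (ENNReal.ofReal x),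
      ← mul_assoc (ENNReal.ofReal (1 - x)), ← ENNReal.ofReal_mul hx0, ← ENNReal.ofReal_mul hy0,
      show x + (1 - x) * b - x * a = x * (1 - a) + (1 - x) * b by ring,
      show 1 - (x + (1 - x) * b) = (1 - x) * (1 - b) by ring]
    rw [← add_assoc, add_comm (ENNReal.ofReal (x * a - 0) * _)]
    simp only [sub_zero, zero_add]
    congr 1
    · congr 3 with s
      congr 1; ring
    · congr 2 with s
      congr 1; ring
  have m1 : Measurable fun z : ℝ × ℝ => ENNReal.ofReal (x * (1 - z.1) + (1 - x) * z.2) *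
      ∫⁻ s, Φ z.1 z.2 (x * z.1 + s * (x * (1 - z.1) + (1 - x) * z.2)) ∂unitUniform := by
    refine Measurable.mul (by fun_prop) (Measurable.lintegral_prod_right ?_)
    apply hΦ.uncurry₃_comp <;> fun_prop
  have m2 : Measurable fun z : ℝ × ℝ => ENNReal.ofReal (x * (1 - z.1)) *
      ∫⁻ s, Φ (z.1 + (1 - z.1) * s) z.2 (x * z.1) ∂unitUniform := by
    refine Measurable.mul (by fun_prop) (Measurable.lintegral_prod_right ?_)
    apply hΦ.uncurry₃_comp <;> fun_prop
  have m2' : Measurable fun z : ℝ × ℝ => ENNReal.ofReal x * (ENNReal.ofReal z.1 *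
      ∫⁻ s, Φ z.1 z.2 (x * (z.1 * s)) ∂unitUniform) := by
    refine Measurable.mul (by fun_prop) (Measurable.mul (by fun_prop)
      (Measurable.lintegral_prod_right ?_))
    apply hΦ.uncurry₃_comp <;> fun_prop
  have L : ∫⁻ a, ∫⁻ b, ∫⁻ c, Φ a b c ∂unitUniform ∂unitUniform ∂unitUniform =
      ∫⁻ a, ∫⁻ b, (ENNReal.ofReal (x * (1 - a) + (1 - x) * b) *
            ∫⁻ s, Φ a b (x * a + s * (x * (1 - a) + (1 - x) * b)) ∂unitUniform +
          ENNReal.ofReal x * (ENNReal.ofReal a *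
            ∫⁻ s, Φ a b (x * (a * s)) ∂unitUniform) +
          ENNReal.ofReal (1 - x) * (ENNReal.ofReal (1 - b) *
            ∫⁻ s, Φ a b (x + (1 - x) * (b + (1 - b) * s)) ∂unitUniform))
          ∂unitUniform ∂unitUniform :=
    setLIntegral_congr_fun measurableSet_Icc fun a ha =>
      setLIntegral_congr_fun measurableSet_Icc fun b hb => split a ha b hb
  -- When `c` is the lowest point, the point drawn from `[0, x]` is the middle one. Exchanging the
  -- two variables makes the lowest point the outer variable `x * a`, and the middle one then runs
  -- over `[x * a, x]`.
  have swap1 : ∫⁻ a, ∫⁻ b, ENNReal.ofReal x * (ENNReal.ofReal a *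
        ∫⁻ s, Φ a b (x * (a * s)) ∂unitUniform) ∂unitUniform ∂unitUniform =
      ∫⁻ a, ∫⁻ b, ENNReal.ofReal (x * (1 - a)) *
        ∫⁻ s, Φ (a + (1 - a) * s) b (x * a) ∂unitUniform ∂unitUniform ∂unitUniform := by
    refine (lintegral_lintegral_swap_of_measurable m2').trans
      (Eq.trans ?_ (lintegral_lintegral_swap_of_measurable m2).symm)
    refine lintegral_congr fun b => ?_
    simp only [ENNReal.ofReal_mul hx0, mul_assoc]
    rw [lintegral_const_mul' _ _ (by simp), lintegral_const_mul' _ _ (by simp)]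
    congr 1
    refine lintegral_triangle_swap (g := fun a c => Φ a b (x * c)) ?_
    apply hΦ.uncurry₃_comp <;> fun_prop
  have swap2 : ∀ a, ∫⁻ b, ENNReal.ofReal (1 - x) * (ENNReal.ofReal (1 - b) *
        ∫⁻ s, Φ a b (x + (1 - x) * (b + (1 - b) * s)) ∂unitUniform) ∂unitUniform =
      ∫⁻ b, ENNReal.ofReal ((1 - x) * b) *
        ∫⁻ s, Φ a (b * s) (x + (1 - x) * b) ∂unitUniform ∂unitUniform := by
    intro a
    simp only [ENNReal.ofReal_mul hy0, mul_assoc]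
    rw [lintegral_const_mul' _ _ (by simp), lintegral_const_mul' _ _ (by simp)]
    congr 1
    refine lintegral_triangle_swap' (g := fun b c => Φ a b (x + (1 - x) * c)) ?_
    apply hΦ.uncurry₃_comp <;> fun_prop
  rw [L]
  refine (lintegral_lintegral_add₃ m1 m2' (fun z => ENNReal.ofReal (1 - x) *
    (ENNReal.ofReal (1 - z.2) *
      ∫⁻ s, Φ z.1 z.2 (x + (1 - x) * (z.2 + (1 - z.2) * s)) ∂unitUniform))).trans
    (Eq.trans ?_ (lintegral_lintegral_add₃ m1 m2 (fun z => ENNReal.ofReal ((1 - x) * z.2) *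
      ∫⁻ s, Φ z.1 (z.2 * s) (x + (1 - x) * z.2) ∂unitUniform)).symm)
  rw [swap1]
  congr 1
  exact lintegral_congr swap2

/-! ### Shape and width of three collinear points -/

/-- The horizontal coordinate of the normalized apex of a triangle with the given side lengths. -/
noncomputable def apexX (u v w : ℝ) : ℝ :=
  (u ^ 2 + v ^ 2 + w ^ 2 - 2 * min u (min v w) ^ 2) / (2 * max u (max v w) ^ 2)

/-- The horizontal coordinate of the normalized apex of a triple of collinear points. -/
noncomputable def flatX (p q r : ℝ) : ℝ := apexX |q - r| |r - p| |p - q|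

/-- The diameter of a triple of collinear points. -/
noncomputable def flatWidth (p q r : ℝ) : ℝ := max |q - r| (max |r - p| |p - q|)

lemma apexX_rotate (u v w : ℝ) : apexX v w u = apexX u v w := by
  rw [apexX, apexX, min_comm u, ← min_assoc, max_comm u, ← max_assoc]
  congr 1
  ring

lemma apexX_swap (u v w : ℝ) : apexX v u w = apexX u v w := by
  rw [apexX, apexX, min_left_comm, max_left_comm]
  congr 1
  ring

lemma flatX_rotate (p q r : ℝ) : flatX q r p = flatX p q r := apexX_rotate _ _ _

lemma flatX_swap (p q r : ℝ) : flatX q p r = flatX p q r := by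
  rw [flatX, flatX, apexX_swap, abs_sub_comm q r, abs_sub_comm r p, abs_sub_comm p q,
    abs_sub_comm r q, abs_sub_comm p r, abs_sub_comm q p]

lemma flatWidth_rotate (p q r : ℝ) : flatWidth q r p = flatWidth p q r := by
  rw [flatWidth, flatWidth, max_comm |q - r|, max_assoc]

lemma flatWidth_swap (p q r : ℝ) : flatWidth q p r = flatWidth p q r := by
  rw [flatWidth, flatWidth, max_left_comm, abs_sub_comm q r, abs_sub_comm r p,
    abs_sub_comm p q]

lemma flatWidth_nonneg (p q r : ℝ) : 0 ≤ flatWidth p q r := le_max_of_le_left (abs_nonneg _)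

lemma max_mul_left {c : ℝ} (hc : 0 ≤ c) (u v : ℝ) : max (c * u) (c * v) = c * max u v :=
  (mul_max_of_nonneg u v hc).symm

lemma min_mul_left {c : ℝ} (hc : 0 ≤ c) (u v : ℝ) : min (c * u) (c * v) = c * min u v :=
  (mul_min_of_nonneg u v hc).symm

lemma apexX_mul {c : ℝ} (hc : 0 < c) (u v w : ℝ) :
    apexX (c * u) (c * v) (c * w) = apexX u v w := by
  simp only [apexX, max_mul_left hc.le, min_mul_left hc.le]
  rw [show (c * u) ^ 2 + (c * v) ^ 2 + (c * w) ^ 2 - 2 * (c * min u (min v w)) ^ 2 =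
    c ^ 2 * (u ^ 2 + v ^ 2 + w ^ 2 - 2 * min u (min v w) ^ 2) by ring,
    show 2 * (c * max u (max v w)) ^ 2 = c ^ 2 * (2 * max u (max v w) ^ 2) by ring,
    mul_div_mul_left _ _ (by positivity)]

lemma abs_affine_sub {c : ℝ} (hc : 0 < c) (d p q : ℝ) :
    |d + c * p - (d + c * q)| = c * |p - q| := by
  rw [show d + c * p - (d + c * q) = c * (p - q) by ring, abs_mul, abs_of_pos hc]

lemma flatX_affine {c : ℝ} (hc : 0 < c) (d p q r : ℝ) :
    flatX (d + c * p) (d + c * q) (d + c * r) = flatX p q r := by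
  simp only [flatX, abs_affine_sub hc, apexX_mul hc]

lemma flatWidth_affine {c : ℝ} (hc : 0 < c) (d p q r : ℝ) :
    flatWidth (d + c * p) (d + c * q) (d + c * r) = c * flatWidth p q r := by
  simp only [flatWidth, abs_affine_sub hc, max_mul_left hc.le]

lemma flatWidth_of_sorted {p s w : ℝ} (hw : 0 ≤ w) (hs : s ∈ Set.Icc (0 : ℝ) 1) :
    flatWidth p (p + s * w) (p + w) = w := by
  obtain ⟨h0, h1⟩ := hs
  have e1 : |p + s * w - (p + w)| = (1 - s) * w := by
    rw [abs_of_nonpos (by nlinarith)]; ring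
  have e2 : |p + w - p| = w := by rw [abs_of_nonneg (by linarith)]; ring
  have e3 : |p - (p + s * w)| = s * w := by rw [abs_of_nonpos (by nlinarith)]; ring
  rw [flatWidth, e1, e2, e3, max_eq_left (show s * w ≤ w by nlinarith), max_eq_right]
  nlinarith

/-- After rescaling, the distances are `s`, `1 - s` and `1`. If `M` and `m` are the larger and the
smaller of the first two, then `M + m = 1` turns the numerator `1 + M ^ 2 - m ^ 2` into `2 * M`. -/
lemma flatX_of_sorted {p s w : ℝ} (hw : 0 < w) (hs : s ∈ Set.Icc (0 : ℝ) 1) :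
    flatX p (p + s * w) (p + w) = max s (1 - s) := by
  obtain ⟨h0, h1⟩ := hs
  have h := flatX_affine hw p 0 s 1
  rw [mul_zero, add_zero, mul_one, mul_comm w] at h
  rw [h, flatX, apexX, abs_of_nonpos (by linarith : s - 1 ≤ 0),
    abs_of_nonpos (by linarith : 0 - s ≤ 0), sub_zero, abs_one, zero_sub, neg_neg, neg_sub,
    max_eq_left h1, max_eq_right (by linarith : 1 - s ≤ 1), min_eq_right h1]
  rcases le_total s (1 - s) with h | h
  · rw [max_eq_right h, min_eq_right h]; ring
  · rw [max_eq_left h, min_eq_left h]; ring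

lemma measurable_apexX : Measurable fun z : ℝ × ℝ × ℝ => apexX z.1 z.2.1 z.2.2 := by
  unfold apexX; fun_prop

lemma measurable_flatX : Measurable fun z : ℝ × ℝ × ℝ => flatX z.1 z.2.1 z.2.2 := by
  unfold flatX apexX; fun_prop

lemma measurable_flatWidth : Measurable fun z : ℝ × ℝ × ℝ => flatWidth z.1 z.2.1 z.2.2 := by
  unfold flatWidth; fun_prop

/-! ### One step from the points `0`, `x`, `1` -/

lemma lintegral_unitUniform_ofReal {f : ℝ → ℝ} (hf : Continuous f)
    (h0 : ∀ a ∈ Set.Icc (0 : ℝ) 1, 0 ≤ f a) :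
    ∫⁻ a, ENNReal.ofReal (f a) ∂unitUniform = ENNReal.ofReal (∫ a in (0 : ℝ)..1, f a) := by
  rw [intervalIntegral.integral_of_le zero_le_one, ← integral_Icc_eq_integral_Ioc,
    ofReal_integral_eq_lintegral_ofReal]
  · exact hf.integrableOn_Icc
  · exact (ae_restrict_mem measurableSet_Icc).mono h0

lemma lintegral_lintegral_unitUniform_ofReal {f : ℝ → ℝ → ℝ} {g : ℝ → ℝ}
    (hf : ∀ a, Continuous (f a)) (hg : Continuous g)
    (h0 : ∀ a ∈ Set.Icc (0 : ℝ) 1, ∀ b ∈ Set.Icc (0 : ℝ) 1, 0 ≤ f a b)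
    (hfg : ∀ a, ∫ b in (0 : ℝ)..1, f a b = g a) :
    ∫⁻ a, ∫⁻ b, ENNReal.ofReal (f a b) ∂unitUniform ∂unitUniform =
      ENNReal.ofReal (∫ a in (0 : ℝ)..1, g a) := by
  rw [← lintegral_unitUniform_ofReal hg]
  · refine setLIntegral_congr_fun measurableSet_Icc fun a ha => ?_
    rw [← hfg]
    exact lintegral_unitUniform_ofReal (hf a) (h0 a ha)
  · intro a ha
    rw [← hfg]
    exact intervalIntegral.integral_nonneg zero_le_one (h0 a ha)

/-- The endpoints form a null set. Without them the width `x * (1 - a) + (1 - x) * b` of the sorted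
triple is positive for every `x` in `[0, 1]`. -/
lemma lintegral_lintegral_congr_Ioo {F G : ℝ → ℝ → ENNReal}
    (h : ∀ a ∈ Set.Ioo (0 : ℝ) 1, ∀ b ∈ Set.Ioo (0 : ℝ) 1, F a b = G a b) :
    ∫⁻ a, ∫⁻ b, F a b ∂unitUniform ∂unitUniform = ∫⁻ a, ∫⁻ b, G a b ∂unitUniform ∂unitUniform :=
  lintegral_congr_ae (ae_unitUniform_mem_Ioo.mono fun a ha =>
    lintegral_congr_ae (ae_unitUniform_mem_Ioo.mono fun b hb => h a ha b hb))

lemma lintegral_lintegral_mono_Ioo {F G : ℝ → ℝ → ENNReal}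
    (h : ∀ a ∈ Set.Ioo (0 : ℝ) 1, ∀ b ∈ Set.Ioo (0 : ℝ) 1, F a b ≤ G a b) :
    ∫⁻ a, ∫⁻ b, F a b ∂unitUniform ∂unitUniform ≤ ∫⁻ a, ∫⁻ b, G a b ∂unitUniform ∂unitUniform :=
  lintegral_mono_ae (ae_unitUniform_mem_Ioo.mono fun a ha =>
    lintegral_mono_ae (ae_unitUniform_mem_Ioo.mono fun b hb => h a ha b hb))

lemma integral_affine_unit (k m : ℝ) : ∫ s in (0 : ℝ)..1, (k + m * s) = k + m / 2 := by
  rw [intervalIntegral.integral_add (by simp) (Continuous.intervalIntegrable (by fun_prop) _ _),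
    intervalIntegral.integral_const_mul, integral_id]
  simp
  ring

/-- The extreme points are fixed at distance `w`. The first term lets the middle point run over the
whole segment; the other two let it run over the parts to the left and to the right of `x`. Each
contributes one copy of the uniform law on the segment, weighted by `w`. -/
lemma flatX_unit_sum {x : ℝ} (hx : x ∈ Set.Icc (0 : ℝ) 1) (f : ℝ → ENNReal) {a b : ℝ}
    (ha : a ∈ Set.Ioo (0 : ℝ) 1) (hb : b ∈ Set.Ioo (0 : ℝ) 1) :
    ENNReal.ofReal (x * (1 - a) + (1 - x) * b) *
          ∫⁻ s, f (flatX (x * a) (x + (1 - x) * b)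
            (x * a + s * (x * (1 - a) + (1 - x) * b))) ∂unitUniform +
        ENNReal.ofReal (x * (1 - a)) *
          ∫⁻ s, f (flatX (x * (a + (1 - a) * s)) (x + (1 - x) * b) (x * a)) ∂unitUniform +
        ENNReal.ofReal ((1 - x) * b) *
          ∫⁻ s, f (flatX (x * a) (x + (1 - x) * (b * s)) (x + (1 - x) * b)) ∂unitUniform =
      2 * (∫⁻ s, f (max s (1 - s)) ∂unitUniform) *
        ENNReal.ofReal (x * (1 - a) + (1 - x) * b) := by
  obtain ⟨hx0, hx1⟩ := hx
  have hα : 0 ≤ x * (1 - a) := mul_nonneg hx0 (by linarith [ha.2])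
  have hβ : 0 ≤ (1 - x) * b := mul_nonneg (by linarith) hb.1.le
  have hw : 0 < x * (1 - a) + (1 - x) * b := by
    rcases hx0.eq_or_lt with rfl | h
    · simpa using hb.1
    · have := mul_pos h (sub_pos.2 ha.2)
      linarith
  set w := x * (1 - a) + (1 - x) * b with hwdef
  have er : x + (1 - x) * b = x * a + w := by rw [hwdef]; ring
  have hτ0 : 0 ≤ x * (1 - a) / w := div_nonneg hα hw.le
  have hτ1 : x * (1 - a) / w ≤ 1 := by rw [div_le_one hw]; linarith
  -- `τ` is the relative position of `x` on the segment between the extreme points.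
  set τ := x * (1 - a) / w with hτ
  have eα : x * (1 - a) = w * τ := by rw [hτ]; field_simp
  have eβ : (1 - x) * b = w * (1 - τ) := by rw [mul_sub, ← eα, hwdef]; ring
  have t1 : ∫⁻ s, f (flatX (x * a) (x + (1 - x) * b) (x * a + s * w)) ∂unitUniform = ∫⁻ s, f (max s (1 - s)) ∂unitUniform := by
    refine setLIntegral_congr_fun measurableSet_Icc fun s hs => ?_
    rw [flatX_rotate, flatX_swap, er, flatX_of_sorted hw hs]
  have t2 : ∫⁻ s, f (flatX (x * (a + (1 - a) * s)) (x + (1 - x) * b) (x * a)) ∂unitUniform =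
      ∫⁻ s, f (max (0 + s * (τ - 0)) (1 - (0 + s * (τ - 0)))) ∂unitUniform := by
    refine setLIntegral_congr_fun measurableSet_Icc fun s hs => ?_
    congr 1
    have hs' : 0 + s * (τ - 0) ∈ Set.Icc (0 : ℝ) 1 :=
      ⟨by nlinarith [hs.1], by nlinarith [hs.1, hs.2]⟩
    rw [← flatX_of_sorted hw hs' (p := x * a), ← er, ← flatX_rotate (x * a)]
    congr 1
    linear_combination s * eα
  have t3 : ∫⁻ s, f (flatX (x * a) (x + (1 - x) * (b * s)) (x + (1 - x) * b)) ∂unitUniform =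
      ∫⁻ s, f (max (τ + s * (1 - τ)) (1 - (τ + s * (1 - τ)))) ∂unitUniform := by
    refine setLIntegral_congr_fun measurableSet_Icc fun s hs => ?_
    congr 1
    have hs' : τ + s * (1 - τ) ∈ Set.Icc (0 : ℝ) 1 :=
      ⟨by nlinarith [hs.1], by nlinarith [hs.1, hs.2]⟩
    rw [← flatX_of_sorted hw hs' (p := x * a), ← er]
    congr 1
    linear_combination s * eβ + eα
  have hsum : ENNReal.ofReal τ * ∫⁻ s, f (max (0 + s * (τ - 0)) (1 - (0 + s * (τ - 0))))
        ∂unitUniform + ENNReal.ofReal (1 - τ) *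
      ∫⁻ s, f (max (τ + s * (1 - τ)) (1 - (τ + s * (1 - τ)))) ∂unitUniform = ∫⁻ s, f (max s (1 - s)) ∂unitUniform := by
    have := lintegral_Icc_split hτ0 hτ1 (fun s => f (max s (1 - s)))
    rw [lintegral_Icc_affine hτ0, lintegral_Icc_affine hτ1, sub_zero] at this
    rw [this, sub_zero]
  rw [t1, t2, t3, eα, eβ, ENNReal.ofReal_mul hw.le, ENNReal.ofReal_mul hw.le, mul_assoc,
    mul_assoc, add_assoc, ← mul_add, hsum]
  ring

/-- The middle point of three independent points, uniform on `[0, x]`, `[x, 1]` and `[0, 1]`,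
divides the segment between the other two in a uniform ratio. -/
lemma lintegral_flatX_unit {x : ℝ} (hx : x ∈ Set.Icc (0 : ℝ) 1) {f : ℝ → ENNReal}
    (hf : Measurable f) :
    ∫⁻ a, ∫⁻ b, ∫⁻ c, f (flatX (x * a) (x + (1 - x) * b) c)
        ∂unitUniform ∂unitUniform ∂unitUniform =
      ∫⁻ s, f (max s (1 - s)) ∂unitUniform := by
  have hm : Measurable fun z : ℝ × ℝ × ℝ => f (flatX (x * z.1) (x + (1 - x) * z.2.1) z.2.2) := by
    refine hf.comp (measurable_flatX.comp (f := fun z : ℝ × ℝ × ℝ =>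
      (x * z.1, x + (1 - x) * z.2.1, z.2.2)) ?_)
    fun_prop
  rw [lintegral_sorted hx (Φ := fun a b c => f (flatX (x * a) (x + (1 - x) * b) c)) hm,
    lintegral_lintegral_congr_Ioo fun a ha b hb => flatX_unit_sum hx f ha hb]
  have hw : Measurable fun z : ℝ × ℝ => ENNReal.ofReal (x * (1 - z.1) + (1 - x) * z.2) := by
    fun_prop
  have hc : ∀ J : ENNReal, ∫⁻ a, ∫⁻ b, J * ENNReal.ofReal (x * (1 - a) + (1 - x) * b)
      ∂unitUniform ∂unitUniform = J * ∫⁻ a, ∫⁻ b, ENNReal.ofReal (x * (1 - a) + (1 - x) * b)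
      ∂unitUniform ∂unitUniform := by
    intro J
    rw [← lintegral_const_mul _ hw.lintegral_prod_right']
    exact lintegral_congr fun a => lintegral_const_mul _ (hw.comp measurable_prodMk_left)
  obtain ⟨hx0, hx1⟩ := hx
  rw [hc,
    lintegral_lintegral_unitUniform_ofReal (g := fun a => x * (1 - a) + (1 - x) / 2)
      (by fun_prop) (by fun_prop)
      (fun a ha b hb => add_nonneg (mul_nonneg hx0 (by linarith [ha.2]))
        (mul_nonneg (by linarith) hb.1))
      (fun a => integral_affine_unit _ _)]
  -- The width of the sorted triple has mean `1 / 2` for every `x`, which cancels the factor `2`.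
  have e : ∫ a in (0 : ℝ)..1, (x * (1 - a) + (1 - x) / 2) = 1 / 2 := by
    rw [show (fun a : ℝ => x * (1 - a) + (1 - x) / 2) = fun a => (x + (1 - x) / 2) + (-x) * a by
      ext a; ring, integral_affine_unit]
    ring
  rw [e, mul_right_comm, show (2 : ENNReal) = ENNReal.ofReal 2 by simp,
    ← ENNReal.ofReal_mul (by norm_num)]
  norm_num

lemma lintegral_ofReal_affine_div {k m w : ℝ} (hw : 0 < w) (hk : 0 ≤ k) (hkm : 0 ≤ k + m) :
    ∫⁻ s, ENNReal.ofReal (k + m * s) / ENNReal.ofReal w ∂unitUniform =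
      ENNReal.ofReal ((k + m / 2) / w) := by
  simp only [div_eq_mul_inv]
  rw [lintegral_mul_const' _ _ (by simpa using hw), lintegral_unitUniform_ofReal (by fun_prop),
    integral_affine_unit, ← div_eq_mul_inv, ← div_eq_mul_inv, ENNReal.ofReal_div_of_pos hw,
    ← div_eq_mul_inv]
  intro a ha
  nlinarith [ha.1, ha.2]

/-- With the extreme points fixed the width is constant, and the numerator is affine in the position
of the middle point. The inner integrals are therefore explicit; only the quotients `α ^ 2 / (α +
β)` and `β ^ 2 / (α + β)` remain to be replaced by linear bounds, where `α = x * (1 - a)` and `β =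
(1 - x) * b`. -/
lemma flatWidth_unit_sum_le {x : ℝ} (hx : x ∈ Set.Icc (0 : ℝ) 1) {a b : ℝ}
    (ha : a ∈ Set.Ioo (0 : ℝ) 1) (hb : b ∈ Set.Ioo (0 : ℝ) 1) {Φ : ℝ → ℝ → ℝ → ENNReal}
    (hΦ : ∀ a b c, Φ a b c = ENNReal.ofReal (a * b * (1 - c) + (1 - a) * (1 - b) * c + 1 / 4) /
      ENNReal.ofReal (flatWidth (x * a) (x + (1 - x) * b) c)) :
    ENNReal.ofReal (x * (1 - a) + (1 - x) * b) *
          ∫⁻ s, Φ a b (x * a + s * (x * (1 - a) + (1 - x) * b)) ∂unitUniform +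
        ENNReal.ofReal (x * (1 - a)) * ∫⁻ s, Φ (a + (1 - a) * s) b (x * a) ∂unitUniform +
        ENNReal.ofReal ((1 - x) * b) * ∫⁻ s, Φ a (b * s) (x + (1 - x) * b) ∂unitUniform ≤
      ENNReal.ofReal (1 / 2 + (x * (1 - a) + (1 - x) * b) * (a + 1 - b) / 2 +
        x * (1 - a) * (1 + a) / 2 + (1 - x) * b * (2 - b) / 2 -
        ((3 * (x * (1 - a)) - (1 - x) * b) / 4 * (1 - b) +
          (3 * ((1 - x) * b) - x * (1 - a)) / 4 * a) / 2) := by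
  obtain ⟨hx0, hx1⟩ := hx
  obtain ⟨ha0, ha1⟩ := ha
  obtain ⟨hb0, hb1⟩ := hb
  have hα : 0 ≤ x * (1 - a) := mul_nonneg hx0 (by linarith)
  have hβ : 0 ≤ (1 - x) * b := mul_nonneg (by linarith) hb0.le
  have hw : 0 < x * (1 - a) + (1 - x) * b := by
    rcases hx0.eq_or_lt with rfl | h
    · simpa using hb0
    · have := mul_pos h (sub_pos.2 ha1)
      linarith
  have t1 : ∫⁻ s, Φ a b (x * a + s * (x * (1 - a) + (1 - x) * b)) ∂unitUniform =
      ENNReal.ofReal ((((x * (1 - a) + (1 - x) * b) * a + 1 / 4) +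
        ((x * (1 - a) + (1 - x) * b) * (1 - b - a)) / 2) / (x * (1 - a) + (1 - x) * b)) := by
    rw [← lintegral_ofReal_affine_div hw (by positivity) (by nlinarith)]
    refine setLIntegral_congr_fun measurableSet_Icc fun s hs => ?_
    rw [hΦ, flatWidth_rotate, flatWidth_swap,
      show x + (1 - x) * b = x * a + (x * (1 - a) + (1 - x) * b) by ring,
      flatWidth_of_sorted hw.le hs]
    congr 2
    ring
  have t2 : ∫⁻ s, Φ (a + (1 - a) * s) b (x * a) ∂unitUniform =
      ENNReal.ofReal ((((x * (1 - a) + (1 - x) * b) * a + 1 / 4) +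
        (b * (1 - x * a) - (x * (1 - a) + (1 - x) * b) * a) / 2) /
          (x * (1 - a) + (1 - x) * b)) := by
    have : 0 ≤ b * (1 - x * a) := mul_nonneg hb0.le (by nlinarith)
    rw [← lintegral_ofReal_affine_div hw (by positivity) (by linarith)]
    refine setLIntegral_congr_fun measurableSet_Icc fun s hs => ?_
    have hs' : s * (x * (1 - a) / (x * (1 - a) + (1 - x) * b)) ∈ Set.Icc (0 : ℝ) 1 :=
      ⟨mul_nonneg hs.1 (by positivity), mul_le_one₀ hs.2 (by positivity)
        ((div_le_one hw).2 (by linarith))⟩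
    rw [hΦ, show x * (a + (1 - a) * s) = x * a + s * (x * (1 - a) /
        (x * (1 - a) + (1 - x) * b)) * (x * (1 - a) + (1 - x) * b) by field_simp,
      show x + (1 - x) * b = x * a + (x * (1 - a) + (1 - x) * b) by ring,
      flatWidth_rotate (x * a), flatWidth_of_sorted hw.le hs']
    congr 2
    ring
  have t3 : ∫⁻ s, Φ a (b * s) (x + (1 - x) * b) ∂unitUniform =
      ENNReal.ofReal ((((1 - a) * (x + (1 - x) * b) + 1 / 4) +
        ((x * (1 - a) + (1 - x) * b) * (1 - b) - (1 - a) * (x + (1 - x) * b)) / 2) /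
          (x * (1 - a) + (1 - x) * b)) := by
    have h1 : 0 ≤ (1 - a) * (x + (1 - x) * b) := mul_nonneg (by linarith) (by linarith)
    have h2 : 0 ≤ (x * (1 - a) + (1 - x) * b) * (1 - b) := mul_nonneg hw.le (by linarith)
    rw [← lintegral_ofReal_affine_div hw (by positivity) (by linarith)]
    refine setLIntegral_congr_fun measurableSet_Icc fun s hs => ?_
    have hs' : (x * (1 - a) + (1 - x) * b * s) / (x * (1 - a) + (1 - x) * b) ∈
        Set.Icc (0 : ℝ) 1 :=
      ⟨div_nonneg (add_nonneg hα (mul_nonneg hβ hs.1)) hw.le,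
        (div_le_one hw).2 (by nlinarith [hs.2])⟩
    rw [hΦ, show x + (1 - x) * (b * s) = x * a + (x * (1 - a) + (1 - x) * b * s) /
        (x * (1 - a) + (1 - x) * b) * (x * (1 - a) + (1 - x) * b) by field_simp; ring,
      show x + (1 - x) * b = x * a + (x * (1 - a) + (1 - x) * b) by ring,
      flatWidth_of_sorted hw.le hs']
    congr 2
    ring
  have h3 : 0 ≤ (1 - a) * (x + (1 - x) * b) := mul_nonneg (by linarith) (by linarith)
  have h2 : 0 ≤ b * (1 - x * a) := mul_nonneg hb0.le (by nlinarith)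
  rw [t1, t2, t3, ← ENNReal.ofReal_mul hw.le, ← ENNReal.ofReal_mul hα, ← ENNReal.ofReal_mul hβ,
    ← ENNReal.ofReal_add, ← ENNReal.ofReal_add]
  · apply ENNReal.ofReal_le_ofReal
    have e2 : b * (1 - x * a) = x * (1 - a) + (1 - x) * b - x * (1 - a) * (1 - b) := by ring
    have e3 : (1 - a) * (x + (1 - x) * b) = x * (1 - a) + (1 - x) * b - (1 - x) * b * a := by ring
    rw [e2, e3]
    generalize x * (1 - a) = α at *
    generalize (1 - x) * b = β at *
    -- Tangent bounds at `α = β`; each amounts to `(α - β) ^ 2 ≥ 0`. The quotients enter with a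
    -- negative sign, so lower bounds are needed.
    have i1 : (3 * α - β) / 4 ≤ α ^ 2 / (α + β) := by
      rw [le_div_iff₀ hw]; nlinarith [sq_nonneg (α - β)]
    have i2 : (3 * β - α) / 4 ≤ β ^ 2 / (α + β) := by
      rw [le_div_iff₀ hw]; nlinarith [sq_nonneg (α - β)]
    have j1 := mul_le_mul_of_nonneg_right i1 (by linarith : 0 ≤ 1 - b)
    have j2 := mul_le_mul_of_nonneg_right i2 ha0.le
    have e : (α + β) * (((α + β) * a + 1 / 4 + (α + β) * (1 - b - a) / 2) / (α + β)) +
        α * (((α + β) * a + 1 / 4 + (α + β - α * (1 - b) - (α + β) * a) / 2) / (α + β)) +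
        β * ((α + β - β * a + 1 / 4 + ((α + β) * (1 - b) - (α + β - β * a)) / 2) / (α + β)) =
        1 / 2 + (α + β) * (a + 1 - b) / 2 + α * (1 + a) / 2 + β * (2 - b) / 2 -
          (α ^ 2 / (α + β) * (1 - b) + β ^ 2 / (α + β) * a) / 2 := by
      field_simp
      ring
    rw [e]
    linarith
  · refine add_nonneg (mul_nonneg hw.le (div_nonneg ?_ hw.le))
      (mul_nonneg hα (div_nonneg ?_ hw.le)) <;> nlinarith
  · refine mul_nonneg hβ (div_nonneg ?_ hw.le)
    nlinarith
  · refine mul_nonneg hw.le (div_nonneg ?_ hw.le)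
    nlinarith
  · refine mul_nonneg hα (div_nonneg ?_ hw.le)
    nlinarith

lemma integral_quadratic_unit (k l m : ℝ) :
    ∫ s in (0 : ℝ)..1, (k + l * s + m * s ^ 2) = k + l / 2 + m / 3 := by
  rw [intervalIntegral.integral_add (Continuous.intervalIntegrable (by fun_prop) _ _)
    (Continuous.intervalIntegrable (by fun_prop) _ _), integral_affine_unit,
    intervalIntegral.integral_const_mul, integral_pow]
  norm_num
  ring

/-- The contraction estimate: `√D ≤ D + 1/4`, and the right-hand side can be integrated. -/
lemma lintegral_sqrt_div_flatWidth_unit_le {x : ℝ} (hx : x ∈ Set.Icc (0 : ℝ) 1) :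
    ∫⁻ a, ∫⁻ b, ∫⁻ c, ENNReal.ofReal (√(a * b * (1 - c) + (1 - a) * (1 - b) * c)) /
        ENNReal.ofReal (flatWidth (x * a) (x + (1 - x) * b) c)
        ∂unitUniform ∂unitUniform ∂unitUniform ≤ ENNReal.ofReal (31 / 32) := by
  have hle : ∀ a ∈ Set.Ioo (0 : ℝ) 1, ∀ b ∈ Set.Ioo (0 : ℝ) 1,
      ∫⁻ c, ENNReal.ofReal (√(a * b * (1 - c) + (1 - a) * (1 - b) * c)) /
        ENNReal.ofReal (flatWidth (x * a) (x + (1 - x) * b) c) ∂unitUniform ≤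
      ∫⁻ c, ENNReal.ofReal (a * b * (1 - c) + (1 - a) * (1 - b) * c + 1 / 4) /
        ENNReal.ofReal (flatWidth (x * a) (x + (1 - x) * b) c) ∂unitUniform := by
    intro a ha b hb
    refine setLIntegral_mono' measurableSet_Icc fun c hc => ?_
    gcongr
    have h : 0 ≤ a * b * (1 - c) + (1 - a) * (1 - b) * c :=
      add_nonneg (mul_nonneg (mul_nonneg ha.1.le hb.1.le) (by linarith [hc.2]))
        (mul_nonneg (mul_nonneg (by linarith [ha.2]) (by linarith [hb.2])) hc.1)
    nlinarith [Real.sq_sqrt h, sq_nonneg (√(a * b * (1 - c) + (1 - a) * (1 - b) * c) - 1 / 2)]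
  refine (lintegral_lintegral_mono_Ioo hle).trans ?_
  have hm : Measurable fun z : ℝ × ℝ × ℝ =>
      ENNReal.ofReal (z.1 * z.2.1 * (1 - z.2.2) + (1 - z.1) * (1 - z.2.1) * z.2.2 + 1 / 4) /
        ENNReal.ofReal (flatWidth (x * z.1) (x + (1 - x) * z.2.1) z.2.2) := by
    refine Measurable.div (by fun_prop) (ENNReal.measurable_ofReal.comp
      (measurable_flatWidth.comp (f := fun z : ℝ × ℝ × ℝ =>
        (x * z.1, x + (1 - x) * z.2.1, z.2.2)) ?_))
    fun_prop
  rw [lintegral_sorted hx (Φ := fun a b c =>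
    ENNReal.ofReal (a * b * (1 - c) + (1 - a) * (1 - b) * c + 1 / 4) /
        ENNReal.ofReal (flatWidth (x * a) (x + (1 - x) * b) c)) hm]
  refine (lintegral_lintegral_mono_Ioo fun a ha b hb =>
    flatWidth_unit_sum_le hx ha hb fun _ _ _ => rfl).trans ?_
  obtain ⟨hx0, hx1⟩ := hx
  rw [lintegral_lintegral_unitUniform_ofReal (g := fun a =>
    (1 / 2 + x * (1 - a) * (a + 1) / 2 + x * (1 - a) * (1 + a) / 2 -
      (3 * (x * (1 - a)) / 4 - x * (1 - a) * a / 4) / 2) +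
    ((1 - x) * (a + 1) / 2 - x * (1 - a) / 2 + (1 - x) -
      (-(1 - x) / 4 - 3 * (x * (1 - a)) / 4 + 3 * (1 - x) * a / 4) / 2) / 2 +
    (-(1 - x) / 2 - (1 - x) / 2 - (1 - x) / 4 / 2) / 3) (by fun_prop) (by fun_prop)]
  · apply ENNReal.ofReal_le_ofReal
    apply le_of_eq
    -- What remains is a quadratic polynomial in `a`; on integration `x` cancels and `31 / 32` is
    -- the exact value.
    calc _ = ∫ a in (0 : ℝ)..1, ((1 / 2 + x - 3 * x / 8 + (1 - x) / 4 - x / 4 + (1 - x) / 2 +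
          (1 - x) / 16 + 3 * x / 16 - 3 * (1 - x) / 8) +
          (3 * x / 8 + x / 8 + (1 - x) / 4 + x / 4 - 3 * x / 16 - 3 * (1 - x) / 16) * a +
          (- x - x / 8) * a ^ 2) := by
          congr 1 with a
          ring
      _ = 31 / 32 := by
          rw [integral_quadratic_unit]
          ring
  · intro a ha b hb
    have hα : 0 ≤ x * (1 - a) := mul_nonneg hx0 (by linarith [ha.2])
    have hβ : 0 ≤ (1 - x) * b := mul_nonneg (by linarith) hb.1
    generalize x * (1 - a) = α at *
    generalize (1 - x) * b = β at *
    nlinarith [mul_nonneg hα ha.1, mul_nonneg hα hb.1, mul_nonneg hβ ha.1, mul_nonneg hβ hb.1,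
      mul_nonneg hα (sub_nonneg.2 ha.2), mul_nonneg hα (sub_nonneg.2 hb.2),
      mul_nonneg hβ (sub_nonneg.2 ha.2), mul_nonneg hβ (sub_nonneg.2 hb.2)]
  · intro a
    rw [← integral_quadratic_unit]
    congr 1 with b
    ring

/-! ### The parameter cube and relabelling of vertices -/

/-- The uniform distribution on the cube `[0, 1]³`. -/
noncomputable abbrev cubeUniform : Measure (Fin 3 → ℝ) := Measure.pi fun _ => unitUniform

/-- For sorted points `q 0 ≤ q 1 ≤ q 2`, parameter `t 2` places a point on the left segment, `t 0`
on the right one, and `t 1` on the whole segment, measured from its right end. This explains the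
order and the reflection `1 - t 1`. -/
lemma measurePreserving_cube_coords :
    MeasurePreserving (fun t : Fin 3 → ℝ => (t 2, (t 0, 1 - t 1))) cubeUniform
      (unitUniform.prod (unitUniform.prod unitUniform)) := by
  have h1 := measurePreserving_piFinSuccAbove (fun _ : Fin 3 => unitUniform) 2
  have h2 := (MeasurePreserving.id unitUniform).prod (measurePreserving_finTwoArrow unitUniform)
  have h3 := (MeasurePreserving.id unitUniform).prod
    ((MeasurePreserving.id unitUniform).prod measurePreserving_one_sub_unitUniform)
  exact h3.comp (h2.comp h1)

lemma lintegral_cubeUniform {F : ℝ → ℝ → ℝ → ENNReal}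
    (hF : Measurable fun z : ℝ × ℝ × ℝ => F z.1 z.2.1 z.2.2) :
    ∫⁻ t, F (t 2) (t 0) (1 - t 1) ∂cubeUniform =
      ∫⁻ a, ∫⁻ b, ∫⁻ c, F a b c ∂unitUniform ∂unitUniform ∂unitUniform := by
  have h := measurePreserving_cube_coords.lintegral_comp hF
  rw [h, lintegral_prod _ hF.aemeasurable]
  refine lintegral_congr fun a => ?_
  exact lintegral_prod _ (hF.comp measurable_prodMk_left).aemeasurable

/-- The ratio of the areas of `subtriangle T t` and `T`. -/
noncomputable def areaRatio (t : Fin 3 → ℝ) : ℝ := ∏ i, t i + ∏ i, (1 - t i)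

/-- The analogue of `subtriangle` for three points on a line. -/
noncomputable def flatSub (q : Fin 3 → ℝ) (t : Fin 3 → ℝ) : Fin 3 → ℝ :=
  fun i => AffineMap.lineMap (q (i + 1)) (q (i + 2)) (t i)

lemma flatSub_apply (q t : Fin 3 → ℝ) (i : Fin 3) :
    flatSub q t i = q (i + 1) + t i * (q (i + 2) - q (i + 1)) := by
  rw [flatSub, AffineMap.lineMap_apply_ring']
  ring

lemma Equiv.Perm.fin_three_cyclic_or_anticyclic : ∀ σ : Equiv.Perm (Fin 3),
    (∀ i, σ (i + 1) = σ i + 1 ∧ σ (i + 2) = σ i + 2) ∨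
      (∀ i, σ (i + 1) = σ i + 2 ∧ σ (i + 2) = σ i + 1) := by
  decide

lemma measurePreserving_comp_perm (σ : Equiv.Perm (Fin 3)) :
    MeasurePreserving (fun t : Fin 3 → ℝ => t ∘ σ) cubeUniform cubeUniform := by
  have h := measurePreserving_piCongrLeft (fun _ : Fin 3 => unitUniform) σ.symm
  convert h using 1
  ext t i
  have h' := MeasurableEquiv.piCongrLeft_apply_apply (β := fun _ => ℝ) σ.symm t (σ i)
  rw [σ.symm_apply_apply] at h'
  exact h'.symm

/-- Relabelling the vertices amounts to a measure-preserving change of the parameters. -/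
lemma exists_measurePreserving_flatSub_comp (σ : Equiv.Perm (Fin 3)) :
    ∃ θ : (Fin 3 → ℝ) → Fin 3 → ℝ, MeasurePreserving θ cubeUniform cubeUniform ∧
      ∀ t, areaRatio (θ t) = areaRatio t ∧ ∀ q, flatSub (q ∘ σ) (θ t) = flatSub q t ∘ σ := by
  rcases Equiv.Perm.fin_three_cyclic_or_anticyclic σ with h | h
  · refine ⟨fun t => t ∘ σ, measurePreserving_comp_perm σ, fun t => ⟨?_, fun q => ?_⟩⟩
    · simp only [areaRatio, Function.comp_apply]
      rw [Equiv.prod_comp σ t, Equiv.prod_comp σ fun i => 1 - t i]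
    · ext i
      simp only [flatSub_apply, Function.comp_apply, (h i).1, (h i).2]
  -- An odd permutation reverses the direction of each side, so each parameter becomes `1 - t`; the
  -- two products in `areaRatio` change places.
  · have hflip : MeasurePreserving (fun (t : Fin 3 → ℝ) i => 1 - t i) cubeUniform cubeUniform :=
      measurePreserving_pi _ _ fun _ => measurePreserving_one_sub_unitUniform
    refine ⟨fun t i => 1 - (t ∘ σ) i, hflip.comp (measurePreserving_comp_perm σ),
      fun t => ⟨?_, fun q => ?_⟩⟩
    · simp only [areaRatio, Function.comp_apply, sub_sub_cancel]
      rw [Equiv.prod_comp σ t, Equiv.prod_comp σ fun i => 1 - t i, add_comm]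
    · ext i
      simp only [flatSub_apply, Function.comp_apply, (h i).1, (h i).2]
      ring

lemma measurable_flatSub : Measurable fun z : (Fin 3 → ℝ) × (Fin 3 → ℝ) => flatSub z.1 z.2 := by
  refine measurable_pi_iff.2 fun i => ?_
  simp only [flatSub_apply]
  fun_prop

lemma measurable_areaRatio : Measurable areaRatio := by
  unfold areaRatio
  fun_prop

/-- Allows the three points to be sorted before a one-step average of a symmetric quantity is
computed. -/
lemma lintegral_flatSub_comp_perm (σ : Equiv.Perm (Fin 3)) (q : Fin 3 → ℝ)
    {Ψ : (Fin 3 → ℝ) × ℝ → ENNReal} (hΨ : Measurable Ψ)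
    (hsymm : ∀ (v : Fin 3 → ℝ) d, Ψ (v ∘ σ, d) = Ψ (v, d)) :
    ∫⁻ t, Ψ (flatSub (q ∘ σ) t, areaRatio t) ∂cubeUniform =
      ∫⁻ t, Ψ (flatSub q t, areaRatio t) ∂cubeUniform := by
  obtain ⟨θ, hθ, h⟩ := exists_measurePreserving_flatSub_comp σ
  have hm : Measurable fun t => Ψ (flatSub (q ∘ σ) t, areaRatio t) :=
    hΨ.comp (Measurable.prodMk (f := fun t => flatSub (q ∘ σ) t) (g := areaRatio)
      (measurable_flatSub.comp (measurable_prodMk_left (x := q ∘ σ))) measurable_areaRatio)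
  rw [← hθ.lintegral_comp hm]
  refine lintegral_congr fun t => ?_
  rw [(h t).1, (h t).2, hsymm]

lemma perm_invariant_of_rotate_of_swap {α : Type*} {f : ℝ → ℝ → ℝ → α}
    (hr : ∀ p q r, f q r p = f p q r) (hs : ∀ p q r, f q p r = f p q r)
    (σ : Equiv.Perm (Fin 3)) (v : Fin 3 → ℝ) :
    f (v (σ 0)) (v (σ 1)) (v (σ 2)) = f (v 0) (v 1) (v 2) := by
  have n01 : σ 0 ≠ σ 1 := by simp
  have n02 : σ 0 ≠ σ 2 := by simp
  have n12 : σ 1 ≠ σ 2 := by simp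
  generalize σ 0 = a at *
  generalize σ 1 = b at *
  generalize σ 2 = c at *
  fin_cases a <;> fin_cases b <;> fin_cases c <;> first
    | exact absurd rfl n01
    | exact absurd rfl n02
    | exact absurd rfl n12
    | rfl
    | exact hr _ _ _
    | exact hs _ _ _
    | exact (hr _ _ _).symm
    | exact (hr _ _ _).trans (hs _ _ _)
    | exact (hr _ _ _).symm.trans (hs _ _ _)

/-! ### One step from arbitrary collinear points -/

/-- Three points on a line that do not all coincide are, up to relabelling and an affine map,
the points `0 ≤ x ≤ 1`. -/
lemma exists_perm_affine_of_flatWidth_pos {q : Fin 3 → ℝ}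
    (hq : 0 < flatWidth (q 0) (q 1) (q 2)) :
    ∃ (σ : Equiv.Perm (Fin 3)) (c x : ℝ), 0 < c ∧ x ∈ Set.Icc (0 : ℝ) 1 ∧
      q (σ 1) = q (σ 0) + c * x ∧ q (σ 2) = q (σ 0) + c ∧
      flatWidth (q 0) (q 1) (q 2) = c := by
  have hmono := Tuple.monotone_sort q
  set σ := Tuple.sort q
  have h01 : q (σ 0) ≤ q (σ 1) := hmono (by decide)
  have h12 : q (σ 1) ≤ q (σ 2) := hmono (by decide)
  rw [← perm_invariant_of_rotate_of_swap flatWidth_rotate flatWidth_swap σ q] at hq ⊢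
  have hc : 0 < q (σ 2) - q (σ 0) := by
    by_contra hcon
    have e1 : q (σ 1) = q (σ 0) := by linarith
    have e2 : q (σ 2) = q (σ 0) := by linarith
    simp [e1, e2, flatWidth] at hq
  have e : q (σ 1) = q (σ 0) + (q (σ 1) - q (σ 0)) / (q (σ 2) - q (σ 0)) *
      (q (σ 2) - q (σ 0)) := by field_simp; ring
  have hmem : (q (σ 1) - q (σ 0)) / (q (σ 2) - q (σ 0)) ∈ Set.Icc (0 : ℝ) 1 :=
    ⟨div_nonneg (by linarith) hc.le, (div_le_one hc).2 (by linarith)⟩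
  refine ⟨σ, q (σ 2) - q (σ 0), (q (σ 1) - q (σ 0)) / (q (σ 2) - q (σ 0)), hc, hmem, ?_, ?_, ?_⟩
  · rw [mul_comm]; exact e
  · ring
  · have := flatWidth_of_sorted (p := q (σ 0)) hc.le hmem
    rwa [← e, add_sub_cancel] at this

lemma flatSub_sorted {q : Fin 3 → ℝ} {c x : ℝ} (h1 : q 1 = q 0 + c * x) (h2 : q 2 = q 0 + c)
    (t : Fin 3 → ℝ) :
    flatSub q t 2 = q 0 + c * (x * t 2) ∧ flatSub q t 0 = q 0 + c * (x + (1 - x) * t 0) ∧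
      flatSub q t 1 = q 0 + c * (1 - t 1) := by
  refine ⟨?_, ?_, ?_⟩ <;> rw [flatSub_apply] <;>
    simp only [Fin.isValue, Fin.reduceAdd, zero_add, h1, h2] <;> ring

/-- One step from any three points on a line: the shape is that of the points `0`, `1` and `s`
with `s` uniform on `[0, 1]`. -/
lemma lintegral_flatX_flatSub {q : Fin 3 → ℝ} (hq : 0 < flatWidth (q 0) (q 1) (q 2))
    {f : ℝ → ENNReal} (hf : Measurable f) :
    ∫⁻ t, f (flatX (flatSub q t 0) (flatSub q t 1) (flatSub q t 2)) ∂cubeUniform =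
      ∫⁻ s, f (max s (1 - s)) ∂unitUniform := by
  obtain ⟨σ, c, x, hc, hx, h1, h2, -⟩ := exists_perm_affine_of_flatWidth_pos hq
  have hΨ : Measurable fun z : (Fin 3 → ℝ) × ℝ => f (flatX (z.1 0) (z.1 1) (z.1 2)) :=
    hf.comp (measurable_flatX.comp (f := fun z : (Fin 3 → ℝ) × ℝ => (z.1 0, z.1 1, z.1 2))
      (by fun_prop))
  rw [← lintegral_flatSub_comp_perm σ q hΨ fun v d =>
    congrArg f (perm_invariant_of_rotate_of_swap flatX_rotate flatX_swap σ v),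
    ← lintegral_flatX_unit hx hf, ← lintegral_cubeUniform (F := fun a b c =>
      f (flatX (x * a) (x + (1 - x) * b) c)) (hf.comp (measurable_flatX.comp
      (f := fun z : ℝ × ℝ × ℝ => (x * z.1, x + (1 - x) * z.2.1, z.2.2)) (by fun_prop)))]
  refine lintegral_congr fun t => ?_
  obtain ⟨e2, e0, e1⟩ := flatSub_sorted (q := q ∘ σ) h1 h2 t
  dsimp only
  rw [e0, e1, e2, flatX_affine hc, flatX_rotate]

/-- One step from any three points on a line: on average the square root of the area decreases
relative to the width. -/
lemma lintegral_sqrt_areaRatio_div_flatWidth_le {q : Fin 3 → ℝ}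
    (hq : 0 < flatWidth (q 0) (q 1) (q 2)) :
    ∫⁻ t, ENNReal.ofReal (√(areaRatio t)) /
        ENNReal.ofReal (flatWidth (flatSub q t 0) (flatSub q t 1) (flatSub q t 2)) ∂cubeUniform ≤
      ENNReal.ofReal (31 / 32) / ENNReal.ofReal (flatWidth (q 0) (q 1) (q 2)) := by
  obtain ⟨σ, c, x, hc, hx, h1, h2, hw⟩ := exists_perm_affine_of_flatWidth_pos hq
  have hΨ : Measurable fun z : (Fin 3 → ℝ) × ℝ => ENNReal.ofReal (√z.2) /
      ENNReal.ofReal (flatWidth (z.1 0) (z.1 1) (z.1 2)) :=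
    Measurable.div (by fun_prop) (ENNReal.measurable_ofReal.comp (measurable_flatWidth.comp
      (f := fun z : (Fin 3 → ℝ) × ℝ => (z.1 0, z.1 1, z.1 2)) (by fun_prop)))
  rw [← lintegral_flatSub_comp_perm σ q hΨ fun v d => congrArg
    (fun y => ENNReal.ofReal (√d) / ENNReal.ofReal y)
    (perm_invariant_of_rotate_of_swap flatWidth_rotate flatWidth_swap σ v), hw]
  have hm : Measurable fun z : ℝ × ℝ × ℝ =>
      ENNReal.ofReal (√(z.1 * z.2.1 * (1 - z.2.2) + (1 - z.1) * (1 - z.2.1) * z.2.2)) /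
        ENNReal.ofReal (flatWidth (x * z.1) (x + (1 - x) * z.2.1) z.2.2) :=
    Measurable.div (by fun_prop) (ENNReal.measurable_ofReal.comp (measurable_flatWidth.comp
      (f := fun z : ℝ × ℝ × ℝ => (x * z.1, x + (1 - x) * z.2.1, z.2.2)) (by fun_prop)))
  have key : ∀ t : Fin 3 → ℝ, ENNReal.ofReal (√(areaRatio t)) / ENNReal.ofReal
        (flatWidth (flatSub (q ∘ σ) t 0) (flatSub (q ∘ σ) t 1) (flatSub (q ∘ σ) t 2)) =
      ENNReal.ofReal (√(t 2 * t 0 * (1 - (1 - t 1)) + (1 - t 2) * (1 - t 0) * (1 - t 1))) /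
        ENNReal.ofReal (flatWidth (x * t 2) (x + (1 - x) * t 0) (1 - t 1)) *
        (ENNReal.ofReal c)⁻¹ := by
    intro t
    obtain ⟨e2, e0, e1⟩ := flatSub_sorted (q := q ∘ σ) h1 h2 t
    rw [e0, e1, e2, flatWidth_affine hc, flatWidth_rotate, ENNReal.ofReal_mul hc.le, mul_comm,
      div_eq_mul_inv, ENNReal.mul_inv (by simp) (by simp [hc]), ← mul_assoc, ← div_eq_mul_inv]
    congr 4
    simp only [areaRatio, Fin.prod_univ_three]
    ring
  simp only [key]
  rw [lintegral_mul_const' _ _ (by simp [hc]), lintegral_cubeUniform (F := fun a b c =>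
    ENNReal.ofReal (√(a * b * (1 - c) + (1 - a) * (1 - b) * c)) /
        ENNReal.ofReal (flatWidth (x * a) (x + (1 - x) * b) c)) hm, div_eq_mul_inv]
  gcongr
  exact lintegral_sqrt_div_flatWidth_unit_le hx

/-- If `s` is uniform on `[0, 1]`, then `max s (1 - s)` is uniform on `[1/2, 1]`. -/
lemma map_max_one_sub_unitUniform :
    unitUniform.map (fun s => max s (1 - s)) = cond volume (Set.Icc (1 / 2 : ℝ) 1) := by
  have hm : Measurable fun s : ℝ => max s (1 - s) := by fun_prop
  ext A hA
  have hi : Measurable (A.indicator (1 : ℝ → ENNReal)) := measurable_one.indicator hA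
  rw [← lintegral_indicator_one hA, lintegral_map hi hm, cond_apply measurableSet_Icc]
  have h := lintegral_Icc_split (u := 0) (v := 1 / 2) (w := 1) (by norm_num) (by norm_num)
    (fun s => A.indicator (1 : ℝ → ENNReal) (max s (1 - s)))
  have h1 : ∫⁻ s in Set.Icc (1 / 2 : ℝ) 1, A.indicator (1 : ℝ → ENNReal) (max s (1 - s)) =
      volume (Set.Icc (1 / 2) 1 ∩ A) := by
    rw [Set.inter_comm, ← Measure.restrict_apply hA, ← lintegral_indicator_one hA]
    refine setLIntegral_congr_fun measurableSet_Icc fun s hs => ?_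
    rw [max_eq_left (by linarith [hs.1])]
  -- The reflection `s ↦ 1 - s` maps the left half to the right half, so the density on `[1/2, 1]`
  -- doubles.
  have h0 : ∫⁻ s in Set.Icc (0 : ℝ) (1 / 2), A.indicator (1 : ℝ → ENNReal) (max s (1 - s)) =
      ∫⁻ s in Set.Icc (1 / 2 : ℝ) 1, A.indicator (1 : ℝ → ENNReal) (max s (1 - s)) := by
    have hp := (Measure.measurePreserving_sub_left (volume : Measure ℝ) 1).restrict_preimage
      (s := Set.Icc (1 / 2 : ℝ) 1) measurableSet_Icc
    have e : (fun a : ℝ => 1 - a) ⁻¹' Set.Icc (1 / 2 : ℝ) 1 = Set.Icc 0 (1 / 2) := by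
      ext a
      simp only [Set.mem_preimage, Set.mem_Icc]
      constructor <;> rintro ⟨h1, h2⟩ <;> constructor <;> linarith
    rw [e] at hp
    refine Eq.trans (lintegral_congr fun s => ?_) (hp.lintegral_comp (hi.comp hm))
    rw [sub_sub_cancel, max_comm]
  rw [show ∫⁻ s, A.indicator (1 : ℝ → ENNReal) (max s (1 - s)) ∂unitUniform =
    ∫⁻ s in Set.Icc 0 1, A.indicator (1 : ℝ → ENNReal) (max s (1 - s)) from rfl, h, h0, h1,
    ← two_mul, Real.volume_Icc, ← ENNReal.ofReal_inv_of_pos (by norm_num)]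
  norm_num

/-! ### Signed area and non-degeneracy -/

/-- Twice the signed area of a triangle. -/
noncomputable def signedArea (T : Fin 3 → Plane) : ℝ :=
  (T 1 0 - T 0 0) * (T 2 1 - T 0 1) - (T 1 1 - T 0 1) * (T 2 0 - T 0 0)

lemma subtriangle_apply (T : Fin 3 → Plane) (t : Fin 3 → ℝ) (i : Fin 3) (j : Fin 2) :
    subtriangle T t i j = T (i + 1) j + t i * (T (i + 2) j - T (i + 1) j) := by
  rw [subtriangle, AffineMap.lineMap_apply]
  simp
  ring

lemma signedArea_subtriangle (T : Fin 3 → Plane) (t : Fin 3 → ℝ) :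
    signedArea (subtriangle T t) = areaRatio t * signedArea T := by
  simp only [signedArea, subtriangle_apply, areaRatio, Fin.prod_univ_three, Fin.isValue,
    Fin.reduceAdd, zero_add]
  ring

lemma affineIndependent_iff_sum_smul (T : Fin 3 → Plane) :
    AffineIndependent ℝ T ↔
      ∀ w : Fin 3 → ℝ, ∑ i, w i = 0 → (∀ j, ∑ i, w i * T i j = 0) → ∀ i, w i = 0 := by
  rw [affineIndependent_iff_of_fintype]
  refine forall_congr' fun w => forall_congr' fun hw => ?_
  rw [Finset.univ.weightedVSub_eq_linear_combination hw]
  refine imp_congr_left ?_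
  rw [PiLp.ext_iff]
  simp

lemma affineIndependent_iff_signedArea_ne_zero (T : Fin 3 → Plane) :
    AffineIndependent ℝ T ↔ signedArea T ≠ 0 := by
  rw [affineIndependent_iff_sum_smul]
  simp only [Fin.sum_univ_three, Fin.forall_fin_two]
  constructor
  · intro h h0
    rw [signedArea] at h0
    -- These weights annihilate one coordinate identically and pair with the other to `±signedArea
    -- T`. Affine independence makes them vanish, which forces `T 0 = T 1`, contradicted by the
    -- weights `1, -1, 0`.
    have a := h ![T 1 0 - T 2 0, T 2 0 - T 0 0, T 0 0 - T 1 0] (by simp)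
      ⟨by simp; ring, by simp; linear_combination -h0⟩
    have b := h ![T 1 1 - T 2 1, T 2 1 - T 0 1, T 0 1 - T 1 1] (by simp)
      ⟨by simp; linear_combination h0, by simp; ring⟩
    have a2 := a 2
    have b2 := b 2
    simp at a2 b2
    have c := h ![1, -1, 0] (by simp) ⟨by simp; linarith, by simp; linarith⟩ 0
    simp at c
  · rintro h w hw ⟨h0, h1⟩
    rw [signedArea] at h
    have e0 : w 0 = -w 1 - w 2 := by linarith
    rw [e0] at h0 h1
    have w1 : w 1 = 0 := by
      refine (mul_eq_zero.1 (?_ : w 1 * _ = 0)).resolve_right h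
      linear_combination (T 2 1 - T 0 1) * h0 - (T 2 0 - T 0 0) * h1
    have w2 : w 2 = 0 := by
      refine (mul_eq_zero.1 (?_ : w 2 * _ = 0)).resolve_right h
      linear_combination (T 1 0 - T 0 0) * h1 - (T 1 1 - T 0 1) * h0
    intro i
    fin_cases i
    · simp [e0, w1, w2]
    · exact w1
    · exact w2

/-! ### Thin triangles and their projections -/

lemma normalizedX_eq_apexX {T : Fin 3 → Plane} (hT : ∃ i j, T i ≠ T j) :
    normalizedX T = apexX (dist (T 1) (T 2)) (dist (T 2) (T 0)) (dist (T 0) (T 1)) := by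
  obtain ⟨x, y, h⟩ := exists_isNormalizedApex hT
  rw [h.normalizedX_eq, h.x_eq, apexX]

/-- The multiple of `e` with the same horizontal coordinate as `f` differs from `f` by a vertical
vector, whose length is the cross product divided by `|e 0|`. -/
lemma abs_norm_sub_le_of_cross {e f : Plane} (he : e 0 ≠ 0) :
    |(‖f‖ - ‖e‖ / |e 0| * |f 0|)| ≤ |e 0 * f 1 - f 0 * e 1| / |e 0| := by
  have h1 : ‖(f 0 / e 0) • e‖ = ‖e‖ / |e 0| * |f 0| := by
    rw [norm_smul, Real.norm_eq_abs, abs_div]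
    ring
  have h2 : ‖f - (f 0 / e 0) • e‖ = |e 0 * f 1 - f 0 * e 1| / |e 0| := by
    rw [EuclideanSpace.norm_eq, Fin.sum_univ_two]
    have z : f 0 - f 0 / e 0 * e 0 = 0 := by field_simp; ring
    simp only [PiLp.sub_apply, PiLp.smul_apply, smul_eq_mul, z, norm_zero]
    rw [zero_pow (by norm_num), zero_add, Real.sqrt_sq (norm_nonneg _), Real.norm_eq_abs,
      ← abs_div]
    congr 1
    field_simp
  rw [← h1, ← h2]
  exact abs_norm_sub_norm_le _ _

lemma abs_coord_le_norm (e : Plane) : |e 0| ≤ ‖e‖ := PiLp.norm_apply_le e 0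

/-- The side lengths of a triangle of small area are almost proportional to those of its
projection to a line. -/
lemma exists_side_lengths_close (T : Fin 3 → Plane)
    (hρ : 0 < flatWidth (T 0 0) (T 1 0) (T 2 0)) :
    ∃ k : ℝ, 1 ≤ k ∧
      |(dist (T 1) (T 2) - k * |T 1 0 - T 2 0|)| ≤
        |signedArea T| / flatWidth (T 0 0) (T 1 0) (T 2 0) ∧
      |(dist (T 2) (T 0) - k * |T 2 0 - T 0 0|)| ≤
        |signedArea T| / flatWidth (T 0 0) (T 1 0) (T 2 0) ∧
      |(dist (T 0) (T 1) - k * |T 0 0 - T 1 0|)| ≤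
        |signedArea T| / flatWidth (T 0 0) (T 1 0) (T 2 0) := by
  have main : ∀ e : Plane, flatWidth (T 0 0) (T 1 0) (T 2 0) = |e 0| →
      (∀ f ∈ ({T 1 - T 2, T 2 - T 0, T 0 - T 1} : Set Plane),
        |e 0 * f 1 - f 0 * e 1| ≤ |signedArea T|) →
      ∃ k : ℝ, 1 ≤ k ∧ ∀ f ∈ ({T 1 - T 2, T 2 - T 0, T 0 - T 1} : Set Plane),
        |(‖f‖ - k * |f 0|)| ≤ |signedArea T| / flatWidth (T 0 0) (T 1 0) (T 2 0) := by
    intro e he hf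
    rw [he] at hρ
    -- `e` is the side with the widest projection; `k` is the ratio of its length to that of its
    -- projection.
    refine ⟨‖e‖ / |e 0|, (one_le_div hρ).2 (abs_coord_le_norm e), fun f hfm => ?_⟩
    rw [he]
    refine (abs_norm_sub_le_of_cross (abs_pos.1 hρ)).trans ?_
    exact div_le_div_of_nonneg_right (hf f hfm) hρ.le
  have out : ∃ k : ℝ, 1 ≤ k ∧ ∀ f ∈ ({T 1 - T 2, T 2 - T 0, T 0 - T 1} : Set Plane),
        |(‖f‖ - k * |f 0|)| ≤ |signedArea T| / flatWidth (T 0 0) (T 1 0) (T 2 0) := by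
    -- The cross product of any two sides is `±signedArea T`, and that of a side with itself is `0`.
    have cross : ∀ x : ℝ, x = signedArea T ∨ x = -signedArea T ∨ x = 0 →
        |x| ≤ |signedArea T| := by
      rintro x (rfl | rfl | rfl)
      · exact le_rfl
      · rw [abs_neg]
      · simp
    rcases max_choice |T 1 0 - T 2 0| (max |T 2 0 - T 0 0| |T 0 0 - T 1 0|) with h | h
    · refine main (T 1 - T 2) h ?_
      rintro f (rfl | rfl | rfl) <;> apply cross <;> simp only [signedArea, PiLp.sub_apply]
      · right; right; ring
      · left; ring
      · right; left; ring
    · rcases max_choice |T 2 0 - T 0 0| |T 0 0 - T 1 0| with h' | h'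
      · refine main (T 2 - T 0) (h.trans h') ?_
        rintro f (rfl | rfl | rfl) <;> apply cross <;> simp only [signedArea, PiLp.sub_apply]
        · right; left; ring
        · right; right; ring
        · left; ring
      · refine main (T 0 - T 1) (h.trans h') ?_
        rintro f (rfl | rfl | rfl) <;> apply cross <;> simp only [signedArea, PiLp.sub_apply]
        · left; ring
        · right; left; ring
        · right; right; ring
  obtain ⟨k, hk, h⟩ := out
  refine ⟨k, hk, ?_, ?_, ?_⟩ <;> rw [dist_eq_norm]
  · exact h _ (by simp)
  · exact h _ (by simp)
  · exact h _ (by simp)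

/-- The constant comes from `|a + b| ≤ 2 + ε ≤ 5 / 2`. -/
lemma abs_sq_sub_sq_le {a b ε : ℝ} (hb0 : 0 ≤ b) (hb1 : b ≤ 1) (h : |a - b| ≤ ε)
    (hε : ε ≤ 1 / 2) : |a ^ 2 - b ^ 2| ≤ 5 / 2 * ε := by
  rw [abs_le] at h ⊢
  constructor <;> nlinarith

/-- Over the common denominator, the five differences of squares enter with coefficients `1`, `1`,
`1`, `2` and at most `3` in absolute value, so the numerator is at most `8 * (5 / 2) * ε = 20 * ε`.
The denominator is at least `1 / 2`, since `max u (max v w) ≥ 1 / 2`. -/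
lemma abs_apexX_sub_le {u v w u' v' w' ε : ℝ} (hu' : 0 ≤ u') (hv' : 0 ≤ v') (hw' : 0 ≤ w')
    (hmax : max u' (max v' w') = 1) (hu : |u - u'| ≤ ε) (hv : |v - v'| ≤ ε) (hw : |w - w'| ≤ ε)
    (hε : ε ≤ 1 / 2) : |apexX u v w - apexX u' v' w'| ≤ 40 * ε := by
  have hu1 : u' ≤ 1 := hmax ▸ le_max_left _ _
  have hv1 : v' ≤ 1 := hmax ▸ (le_max_left _ _).trans (le_max_right _ _)
  have hw1 : w' ≤ 1 := hmax ▸ (le_max_right _ _).trans (le_max_right _ _)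
  have hM : |max u (max v w) - 1| ≤ ε := by
    rw [← hmax]
    exact (abs_max_sub_max_le_max _ _ _ _).trans
      (max_le hu ((abs_max_sub_max_le_max _ _ _ _).trans (max_le hv hw)))
  have hm : |min u (min v w) - min u' (min v' w')| ≤ ε :=
    (abs_min_sub_min_le_max _ _ _ _).trans
      (max_le hu ((abs_min_sub_min_le_max _ _ _ _).trans (max_le hv hw)))
  have hm0 : 0 ≤ min u' (min v' w') := le_min hu' (le_min hv' hw')
  have hm1 : min u' (min v' w') ≤ 1 := (min_le_left _ _).trans hu1
  have s1 := abs_sq_sub_sq_le hu' hu1 hu hε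
  have s2 := abs_sq_sub_sq_le hv' hv1 hv hε
  have s3 := abs_sq_sub_sq_le hw' hw1 hw hε
  have s4 := abs_sq_sub_sq_le hm0 hm1 hm hε
  have s5 := abs_sq_sub_sq_le zero_le_one le_rfl hM hε
  rw [apexX, apexX, hmax]
  generalize max u (max v w) = M at *
  generalize min u (min v w) = m at *
  generalize min u' (min v' w') = m' at *
  have hM2 : 1 / 4 ≤ M ^ 2 := by
    rw [abs_le] at hM
    nlinarith
  have hε0 : 0 ≤ ε := (abs_nonneg _).trans hu
  have e : (u ^ 2 + v ^ 2 + w ^ 2 - 2 * m ^ 2) / (2 * M ^ 2) -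
      (u' ^ 2 + v' ^ 2 + w' ^ 2 - 2 * m' ^ 2) / (2 * 1 ^ 2) =
      ((u ^ 2 - u' ^ 2) + (v ^ 2 - v' ^ 2) + (w ^ 2 - w' ^ 2) - 2 * (m ^ 2 - m' ^ 2) -
        (u' ^ 2 + v' ^ 2 + w' ^ 2 - 2 * m' ^ 2) * (M ^ 2 - 1 ^ 2)) / (2 * M ^ 2) := by
    have : M ≠ 0 := by
      rintro rfl
      norm_num at hM2
    field_simp
    ring
  have hN : |u' ^ 2 + v' ^ 2 + w' ^ 2 - 2 * m' ^ 2| ≤ 3 := by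
    rw [abs_le]
    constructor <;> nlinarith
  have hNM := mul_le_mul hN s5 (abs_nonneg _) (by norm_num)
  rw [← abs_mul] at hNM
  rw [e, abs_div, abs_of_nonneg (by positivity : 0 ≤ 2 * M ^ 2), div_le_iff₀ (by positivity)]
  have : |(u ^ 2 - u' ^ 2) + (v ^ 2 - v' ^ 2) + (w ^ 2 - w' ^ 2) - 2 * (m ^ 2 - m' ^ 2) -
        (u' ^ 2 + v' ^ 2 + w' ^ 2 - 2 * m' ^ 2) * (M ^ 2 - 1 ^ 2)| ≤ 20 * ε := by
    rw [abs_le] at *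
    constructor <;> linarith
  nlinarith

/-- A triangle of small area has almost the same normalized apex as its projection to a line. -/
lemma abs_normalizedX_sub_flatX_le {T : Fin 3 → Plane} {ε : ℝ} (hε : ε ≤ 1 / 2)
    (hρ : 0 < flatWidth (T 0 0) (T 1 0) (T 2 0))
    (h : |signedArea T| ≤ ε * flatWidth (T 0 0) (T 1 0) (T 2 0) ^ 2) :
    |normalizedX T - flatX (T 0 0) (T 1 0) (T 2 0)| ≤ 40 * ε := by
  have hne : ∃ i j, T i ≠ T j := by
    by_contra hcon
    push Not at hcon
    simp [hcon 1 0, hcon 2 0, flatWidth] at hρ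
  obtain ⟨k, hk, h0, h1, h2⟩ := exists_side_lengths_close T hρ
  have hmax : flatWidth (T 0 0) (T 1 0) (T 2 0) =
    max |T 1 0 - T 2 0| (max |T 2 0 - T 0 0| |T 0 0 - T 1 0|) := rfl
  rw [normalizedX_eq_apexX hne, flatX]
  generalize flatWidth (T 0 0) (T 1 0) (T 2 0) = ρ at *
  have hkρ : 0 < k * ρ := by positivity
  -- Side lengths are divided by `k * ρ` and projected lengths by `ρ`. The latter then have maximum
  -- `1`, and corresponding lengths differ by at most `ε`.
  rw [← apexX_mul (inv_pos.2 hkρ), ← apexX_mul (inv_pos.2 hρ) |T 1 0 - T 2 0|]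
  have bound : ∀ d p : ℝ, |d - k * p| ≤ |signedArea T| / ρ →
      |(k * ρ)⁻¹ * d - ρ⁻¹ * p| ≤ ε := by
    intro d p hd
    rw [show (k * ρ)⁻¹ * d - ρ⁻¹ * p = (d - k * p) / (k * ρ) by field_simp, abs_div,
      abs_of_pos hkρ, div_le_iff₀ hkρ]
    have hε0 : 0 ≤ ε := by
      by_contra hneg
      have : ε * ρ ^ 2 < 0 := mul_neg_of_neg_of_pos (not_le.1 hneg) (by positivity)
      linarith [abs_nonneg (signedArea T)]
    calc |d - k * p| ≤ |signedArea T| / ρ := hd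
      _ ≤ ε * ρ := by rw [div_le_iff₀ hρ]; linarith
      _ ≤ ε * (k * ρ) := by gcongr; nlinarith
  refine abs_apexX_sub_le (by positivity) (by positivity) (by positivity) ?_ (bound _ _ h0)
    (bound _ _ h1) (bound _ _ h2) hε
  rw [max_mul_left (by positivity), max_mul_left (by positivity), ← hmax, inv_mul_cancel₀ hρ.ne']

/-! ### Flatness, measurability and contraction -/

lemma subtriangle_coord_zero (T : Fin 3 → Plane) (t : Fin 3 → ℝ) (i : Fin 3) :
    subtriangle T t i 0 = flatSub (fun i => T i 0) t i := by
  rw [subtriangle_apply, flatSub_apply]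

/-- The square root of the area of a triangle relative to the width of its projection. -/
noncomputable def flatness (T : Fin 3 → Plane) : ENNReal :=
  ENNReal.ofReal (√|signedArea T|) / ENNReal.ofReal (flatWidth (T 0 0) (T 1 0) (T 2 0))

lemma measurable_plane_coord (i : Fin 3) (j : Fin 2) :
    Measurable fun T : Fin 3 → Plane => T i j := by
  fun_prop

lemma measurable_projections :
    Measurable fun T : Fin 3 → Plane => (T 0 0, T 1 0, T 2 0) :=
  (measurable_plane_coord 0 0).prodMk ((measurable_plane_coord 1 0).prodMk
    (measurable_plane_coord 2 0))

lemma measurable_flatX_projections :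
    Measurable fun T : Fin 3 → Plane => flatX (T 0 0) (T 1 0) (T 2 0) :=
  measurable_flatX.comp (f := fun T : Fin 3 → Plane => (T 0 0, T 1 0, T 2 0))
    measurable_projections

lemma AEMeasurable.flatX {Ω : Type*} [MeasurableSpace Ω] {P : Measure Ω} {T : Ω → Fin 3 → Plane}
    (hT : AEMeasurable T P) : AEMeasurable (fun ω => flatX (T ω 0 0) (T ω 1 0) (T ω 2 0)) P :=
  measurable_flatX_projections.comp_aemeasurable hT

lemma measurable_signedArea : Measurable signedArea := by
  unfold signedArea
  fun_prop

lemma measurable_flatness : Measurable flatness :=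
  Measurable.div (ENNReal.measurable_ofReal.comp (Real.continuous_sqrt.measurable.comp
    (continuous_abs.measurable.comp measurable_signedArea)))
    (ENNReal.measurable_ofReal.comp (measurable_flatWidth.comp measurable_projections))

lemma Measurable.subtriangle {α : Type*} [MeasurableSpace α] {f : α → Fin 3 → Plane}
    {g : α → Fin 3 → ℝ} (hf : Measurable f) (hg : Measurable g) :
    Measurable fun a => subtriangle (f a) (g a) := by
  refine measurable_pi_iff.2 fun i => ?_
  simp only [_root_.subtriangle, AffineMap.lineMap_apply, vsub_eq_sub, vadd_eq_add]
  fun_prop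

lemma measurable_triangleSeq (T₀ : Fin 3 → Plane) (n : ℕ) :
    Measurable fun ξ : ℕ → Fin 3 → ℝ => triangleSeq T₀ ξ n := by
  induction n with
  | zero => exact measurable_const
  | succ n ih =>
    simp only [triangleSeq]
    exact ih.subtriangle (measurable_pi_apply n)

lemma triangleSeq_congr (T₀ : Fin 3 → Plane) {ξ η : ℕ → Fin 3 → ℝ} {n : ℕ}
    (h : ∀ k < n, ξ k = η k) : triangleSeq T₀ ξ n = triangleSeq T₀ η n := by
  induction n with
  | zero => rfl
  | succ n ih =>
    rw [triangleSeq, triangleSeq, ih fun k hk => h k (by omega), h n (by omega)]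

lemma ae_cubeUniform_mem_Ioo : ∀ᵐ t ∂cubeUniform, ∀ i, t i ∈ Set.Ioo (0 : ℝ) 1 :=
  ae_all_iff.2 fun i =>
    (Measure.tendsto_eval_ae_ae (μ := fun _ : Fin 3 => unitUniform) (i := i)).eventually
      ae_unitUniform_mem_Ioo

lemma areaRatio_pos {t : Fin 3 → ℝ} (ht : ∀ i, t i ∈ Set.Ioo (0 : ℝ) 1) : 0 < areaRatio t :=
  add_pos (Finset.prod_pos fun i _ => (ht i).1)
    (Finset.prod_pos fun i _ => sub_pos.2 (ht i).2)

/-- The flatness is contracted on average. -/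
lemma lintegral_flatness_subtriangle_le (T : Fin 3 → Plane) :
    ∫⁻ t, flatness (subtriangle T t) ∂cubeUniform ≤ ENNReal.ofReal (31 / 32) * flatness T := by
  rcases eq_or_ne (signedArea T) 0 with hA | hA
  · simp [flatness, signedArea_subtriangle, hA]
  rcases (flatWidth_nonneg (T 0 0) (T 1 0) (T 2 0)).eq_or_lt with hw | hw
  -- Nonzero area over zero width is `⊤` in `ENNReal`, so the bound is trivial here.
  · have : flatness T = ⊤ := by
      rw [flatness, ← hw, ENNReal.ofReal_zero, ENNReal.div_zero]
      simpa using hA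
    rw [this, ENNReal.mul_top (by simp)]
    exact le_top
  -- The area of `T` factors out, leaving an integrand that depends only on the projection and the
  -- parameters.
  have key : ∀ᵐ t ∂cubeUniform, flatness (subtriangle T t) =
      ENNReal.ofReal (√|signedArea T|) * (ENNReal.ofReal (√(areaRatio t)) /
        ENNReal.ofReal (flatWidth (flatSub (fun i => T i 0) t 0) (flatSub (fun i => T i 0) t 1)
          (flatSub (fun i => T i 0) t 2))) := by
    filter_upwards [ae_cubeUniform_mem_Ioo] with t ht
    rw [flatness, signedArea_subtriangle, subtriangle_coord_zero, subtriangle_coord_zero,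
      subtriangle_coord_zero, abs_mul, abs_of_pos (areaRatio_pos ht),
      Real.sqrt_mul (areaRatio_pos ht).le, ENNReal.ofReal_mul (Real.sqrt_nonneg _),
      mul_comm (ENNReal.ofReal (√(areaRatio t))), mul_div_assoc]
  rw [lintegral_congr_ae key, lintegral_const_mul' _ _ (by simp), flatness]
  calc _ ≤ ENNReal.ofReal (√|signedArea T|) * (ENNReal.ofReal (31 / 32) /
        ENNReal.ofReal (flatWidth (T 0 0) (T 1 0) (T 2 0))) := by
        gcongr
        exact lintegral_sqrt_areaRatio_div_flatWidth_le (q := fun i => T i 0) hw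
    _ = _ := by
        simp only [div_eq_mul_inv]
        ring

/-! ### The random sequence of triangles -/

lemma cond_volume_Icc_zero_one : cond volume (Set.Icc (0 : ℝ) 1) = unitUniform := by
  simp [ProbabilityTheory.cond]

lemma aemeasurable_of_isUniform {Ω : Type*} [MeasurableSpace Ω] {P : Measure Ω}
    {ξ : ℕ → Fin 3 → Ω → ℝ}
    (hξ_unif : ∀ n i, pdf.IsUniform (ξ n i) (Set.Icc 0 1) P volume)
    (n : ℕ) (i : Fin 3) : AEMeasurable (ξ n i) P :=
  (hξ_unif n i).aemeasurable (by simp) (by simp)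

section RandomTriangles

variable {Ω : Type*} [MeasurableSpace Ω] {P : Measure Ω}
  {T₀ : Fin 3 → Plane} {ξ : ℕ → Fin 3 → Ω → ℝ}

lemma aemeasurable_triangleSeq
    (hξ_unif : ∀ n i, pdf.IsUniform (ξ n i) (Set.Icc 0 1) P volume) (n : ℕ) :
    AEMeasurable (fun ω => triangleSeq T₀ (fun k i => ξ k i ω) n) P :=
  (measurable_triangleSeq T₀ n).comp_aemeasurable (aemeasurable_pi_lambda _ fun k =>
    aemeasurable_pi_lambda _ fun i => aemeasurable_of_isUniform hξ_unif k i)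

lemma map_parameters_eq_cubeUniform [IsProbabilityMeasure P]
    (hξ_indep : iIndepFun (fun p : ℕ × Fin 3 => ξ p.1 p.2) P)
    (hξ_unif : ∀ n i, pdf.IsUniform (ξ n i) (Set.Icc 0 1) P volume) (n : ℕ) :
    P.map (fun ω i => ξ n i ω) = cubeUniform := by
  have h : iIndepFun (fun i => ξ n i) P :=
    hξ_indep.precomp (g := fun i : Fin 3 => (n, i)) (Prod.mk_right_injective n)
  rw [(iIndepFun_iff_map_fun_eq_pi_map fun i => aemeasurable_of_isUniform hξ_unif n i).1 h]
  congr 1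
  ext1 i
  exact (hξ_unif n i).trans cond_volume_Icc_zero_one

/-- The `n`-th triangle is a function of the parameters with index below `n`, a finite family
disjoint from those of step `n`. -/
lemma indepFun_triangleSeq
    (hξ_indep : iIndepFun (fun p : ℕ × Fin 3 => ξ p.1 p.2) P)
    (hξ_unif : ∀ n i, pdf.IsUniform (ξ n i) (Set.Icc 0 1) P volume) (n : ℕ) :
    IndepFun (fun ω => triangleSeq T₀ (fun k i => ξ k i ω) n) (fun ω i => ξ n i ω) P := by
  classical
  let S : Finset (ℕ × Fin 3) := Finset.range n ×ˢ Finset.univ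
  let S' : Finset (ℕ × Fin 3) := {n} ×ˢ Finset.univ
  have hd : Disjoint S S' := by
    rw [Finset.disjoint_left]
    rintro ⟨k, i⟩ h h'
    simp only [S, S', Finset.mem_product, Finset.mem_range, Finset.mem_singleton,
      Finset.mem_univ, and_true] at h h'
    omega
  have h := hξ_indep.indepFun_finset₀ S S' hd fun p => aemeasurable_of_isUniform hξ_unif p.1 p.2
  -- The value `0` for later parameters is arbitrary: `triangleSeq_congr` shows that they do not
  -- affect the `n`-th triangle.
  let extend : (S → ℝ) → ℕ → Fin 3 → ℝ := fun g k i =>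
    if hk : (k, i) ∈ S then g ⟨(k, i), hk⟩ else 0
  have hext : Measurable extend := by
    refine measurable_pi_lambda _ fun k => measurable_pi_lambda _ fun i => ?_
    by_cases hk : (k, i) ∈ S
    · simp only [extend, hk, dite_true]
      exact measurable_pi_apply _
    · simp only [extend, hk, dite_false]
      exact measurable_const
  let last : (S' → ℝ) → Fin 3 → ℝ := fun g i => g ⟨(n, i), by simp [S']⟩
  have hlast : Measurable last := measurable_pi_lambda _ fun i => measurable_pi_apply _
  have h' := h.comp ((measurable_triangleSeq T₀ n).comp hext) hlast
  convert h' using 1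
  · ext1 ω
    refine triangleSeq_congr T₀ fun k hk => ?_
    ext i
    have : (k, i) ∈ S := by simp [S, hk]
    simp [extend, this]
  · rfl

/-- The Markov property in integrated form: the current triangle is frozen while the next parameters
are averaged, so that the deterministic one-step results apply. -/
lemma lintegral_triangleSeq_parameters [IsProbabilityMeasure P]
    (hξ_indep : iIndepFun (fun p : ℕ × Fin 3 => ξ p.1 p.2) P)
    (hξ_unif : ∀ n i, pdf.IsUniform (ξ n i) (Set.Icc 0 1) P volume) (n : ℕ)
    {H : (Fin 3 → Plane) × (Fin 3 → ℝ) → ENNReal} (hH : Measurable H) :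
    ∫⁻ ω, H (triangleSeq T₀ (fun k i => ξ k i ω) n, fun i => ξ n i ω) ∂P =
      ∫⁻ ω, ∫⁻ t, H (triangleSeq T₀ (fun k i => ξ k i ω) n, t) ∂cubeUniform ∂P := by
  have hT := aemeasurable_triangleSeq (T₀ := T₀) hξ_unif n
  have hX : AEMeasurable (fun ω i => ξ n i ω) P :=
    aemeasurable_pi_lambda _ fun i => aemeasurable_of_isUniform hξ_unif n i
  have h := (indepFun_triangleSeq (T₀ := T₀) hξ_indep hξ_unif n).map_prod_eq_prod_map_map hT hX
  rw [map_parameters_eq_cubeUniform hξ_indep hξ_unif] at h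
  rw [← lintegral_map' hH.aemeasurable (hT.prodMk hX), h, lintegral_prod _ hH.aemeasurable,
    lintegral_map' hH.lintegral_prod_right'.aemeasurable hT]

lemma lintegral_flatness_triangleSeq_le [IsProbabilityMeasure P]
    (hξ_indep : iIndepFun (fun p : ℕ × Fin 3 => ξ p.1 p.2) P)
    (hξ_unif : ∀ n i, pdf.IsUniform (ξ n i) (Set.Icc 0 1) P volume) (n : ℕ) :
    ∫⁻ ω, flatness (triangleSeq T₀ (fun k i => ξ k i ω) n) ∂P ≤
      ENNReal.ofReal (31 / 32) ^ n * flatness T₀ := by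
  induction n with
  | zero => simp [triangleSeq]
  | succ n ih =>
    have h := lintegral_triangleSeq_parameters (T₀ := T₀) hξ_indep hξ_unif n
      (measurable_flatness.comp (measurable_fst.subtriangle measurable_snd))
    calc _ = _ := h
      _ ≤ ∫⁻ ω, ENNReal.ofReal (31 / 32) * flatness (triangleSeq T₀ (fun k i => ξ k i ω) n) ∂P :=
        lintegral_mono fun ω => lintegral_flatness_subtriangle_le _
      _ = ENNReal.ofReal (31 / 32) * ∫⁻ ω, flatness (triangleSeq T₀ (fun k i => ξ k i ω) n) ∂P :=
        lintegral_const_mul' _ _ (by simp)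
      _ ≤ _ := by
        rw [pow_succ', mul_assoc]
        gcongr

lemma ae_signedArea_triangleSeq_ne_zero (hT₀ : signedArea T₀ ≠ 0)
    (hξ_unif : ∀ n i, pdf.IsUniform (ξ n i) (Set.Icc 0 1) P volume) :
    ∀ᵐ ω ∂P, ∀ n, signedArea (triangleSeq T₀ (fun k i => ξ k i ω) n) ≠ 0 := by
  have h : ∀ᵐ ω ∂P, ∀ n i, ξ n i ω ∈ Set.Ioo (0 : ℝ) 1 := by
    refine ae_all_iff.2 fun n => ae_all_iff.2 fun i => ?_
    refine ae_of_ae_map (aemeasurable_of_isUniform hξ_unif n i) ?_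
    rw [(hξ_unif n i).trans cond_volume_Icc_zero_one]
    exact ae_unitUniform_mem_Ioo
  filter_upwards [h] with ω hω n
  induction n with
  | zero => exact hT₀
  | succ n ih =>
    rw [triangleSeq, signedArea_subtriangle]
    exact mul_ne_zero (areaRatio_pos (hω n)).ne' ih

lemma flatness_ne_top_of_flatWidth_pos {T : Fin 3 → Plane}
    (h : 0 < flatWidth (T 0 0) (T 1 0) (T 2 0)) : flatness T ≠ ⊤ :=
  ENNReal.div_ne_top (by simp) (by simpa using h)

lemma flatWidth_pos_of_signedArea_ne_zero {T : Fin 3 → Plane} (hA : signedArea T ≠ 0) :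
    0 < flatWidth (T 0 0) (T 1 0) (T 2 0) := by
  refine (flatWidth_nonneg _ _ _).lt_of_ne fun hw => hA ?_
  have h1 : |T 2 0 - T 0 0| ≤ 0 := hw ▸ (le_max_left _ _).trans (le_max_right _ _)
  have h2 : |T 0 0 - T 1 0| ≤ 0 := hw ▸ (le_max_right _ _).trans (le_max_right _ _)
  rw [signedArea, abs_nonpos_iff.1 h1, ← neg_sub (T 0 0), abs_nonpos_iff.1 h2]
  ring

/-- The law is exact after every step because the one-step average does not depend on the previous
triangle, as long as its projection has positive width. -/
lemma map_flatX_triangleSeq_succ [IsProbabilityMeasure P] (hT₀ : signedArea T₀ ≠ 0)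
    (hξ_indep : iIndepFun (fun p : ℕ × Fin 3 => ξ p.1 p.2) P)
    (hξ_unif : ∀ n i, pdf.IsUniform (ξ n i) (Set.Icc 0 1) P volume) (n : ℕ) :
    P.map (fun ω => flatX (triangleSeq T₀ (fun k i => ξ k i ω) (n + 1) 0 0)
      (triangleSeq T₀ (fun k i => ξ k i ω) (n + 1) 1 0)
      (triangleSeq T₀ (fun k i => ξ k i ω) (n + 1) 2 0)) =
      cond volume (Set.Icc (1 / 2 : ℝ) 1) := by
  have hm : Measurable fun s : ℝ => max s (1 - s) := by fun_prop
  rw [← map_max_one_sub_unitUniform]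
  ext A hA
  have hi : Measurable (A.indicator (1 : ℝ → ENNReal)) := measurable_one.indicator hA
  have hae : AEMeasurable (fun ω => flatX (triangleSeq T₀ (fun k i => ξ k i ω) (n + 1) 0 0)
      (triangleSeq T₀ (fun k i => ξ k i ω) (n + 1) 1 0)
      (triangleSeq T₀ (fun k i => ξ k i ω) (n + 1) 2 0)) P :=
    (aemeasurable_triangleSeq (T₀ := T₀) hξ_unif (n + 1)).flatX
  rw [← lintegral_indicator_one hA, ← lintegral_indicator_one hA, lintegral_map hi hm,
    lintegral_map' hi.aemeasurable hae]
  have hH : Measurable fun z : (Fin 3 → Plane) × (Fin 3 → ℝ) => A.indicator (1 : ℝ → ENNReal)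
      (flatX (subtriangle z.1 z.2 0 0) (subtriangle z.1 z.2 1 0) (subtriangle z.1 z.2 2 0)) :=
    hi.comp (measurable_flatX_projections.comp (measurable_fst.subtriangle measurable_snd))
  simp only [triangleSeq]
  rw [lintegral_triangleSeq_parameters (T₀ := T₀) hξ_indep hξ_unif n hH]
  have key : ∀ᵐ ω ∂P, ∫⁻ t, A.indicator (1 : ℝ → ENNReal)
      (flatX (subtriangle (triangleSeq T₀ (fun k i => ξ k i ω) n) t 0 0)
        (subtriangle (triangleSeq T₀ (fun k i => ξ k i ω) n) t 1 0)
        (subtriangle (triangleSeq T₀ (fun k i => ξ k i ω) n) t 2 0)) ∂cubeUniform =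
      ∫⁻ s, A.indicator (1 : ℝ → ENNReal) (max s (1 - s)) ∂unitUniform := by
    filter_upwards [ae_signedArea_triangleSeq_ne_zero hT₀ hξ_unif] with ω hω
    rw [← lintegral_flatX_flatSub (q := fun i => triangleSeq T₀ (fun k i => ξ k i ω) n i 0)
      (flatWidth_pos_of_signedArea_ne_zero (hω n)) hi]
    refine lintegral_congr fun t => ?_
    simp only [subtriangle_coord_zero]
  rw [lintegral_congr_ae key, lintegral_const, measure_univ, mul_one]

lemma abs_normalizedX_sub_flatX_lt {T : Fin 3 → Plane} (hA : signedArea T ≠ 0) {δ ε : ℝ}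
    (hε0 : 0 < ε) (hε : ε ≤ 1 / 2) (hδ : 40 * ε < δ) (h : flatness T < ENNReal.ofReal (√ε)) :
    |normalizedX T - flatX (T 0 0) (T 1 0) (T 2 0)| < δ := by
  have hw := flatWidth_pos_of_signedArea_ne_zero hA
  rw [flatness, ← ENNReal.ofReal_div_of_pos hw,
    ENNReal.ofReal_lt_ofReal_iff (Real.sqrt_pos.2 hε0), div_lt_iff₀ hw] at h
  refine (abs_normalizedX_sub_flatX_le hε hw ?_).trans_lt hδ
  have h2 := pow_le_pow_left₀ (Real.sqrt_nonneg _) h.le 2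
  rwa [mul_pow, Real.sq_sqrt (abs_nonneg _), Real.sq_sqrt hε0.le] at h2

/-- A deviation of at least `δ` forces the flatness to be at least `√ε`; by Markov's inequality the
probability of this decays geometrically. -/
lemma tendstoInMeasure_normalizedX_sub_flatX [IsProbabilityMeasure P] (hT₀ : signedArea T₀ ≠ 0)
    (hξ_indep : iIndepFun (fun p : ℕ × Fin 3 => ξ p.1 p.2) P)
    (hξ_unif : ∀ n i, pdf.IsUniform (ξ n i) (Set.Icc 0 1) P volume) :
    TendstoInMeasure P
      ((fun n ω => normalizedX (triangleSeq T₀ (fun k i => ξ k i ω) n)) -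
        fun n ω => flatX (triangleSeq T₀ (fun k i => ξ k i ω) n 0 0)
          (triangleSeq T₀ (fun k i => ξ k i ω) n 1 0)
          (triangleSeq T₀ (fun k i => ξ k i ω) n 2 0)) atTop 0 := by
  rw [tendstoInMeasure_iff_norm]
  intro δ hδ
  set ε := min (1 / 2) (δ / 80) with hεdef
  have hε0 : 0 < ε := lt_min (by norm_num) (by positivity)
  have hε : ε ≤ 1 / 2 := min_le_left _ _
  have hεδ : 40 * ε < δ := by linarith [min_le_right (1 / 2) (δ / 80)]
  have hη : ENNReal.ofReal (√ε) ≠ 0 := by simpa using hε0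
  have bound : ∀ n, P {ω | δ ≤ ‖((fun n ω => normalizedX (triangleSeq T₀ (fun k i => ξ k i ω) n)) -
        fun n ω => flatX (triangleSeq T₀ (fun k i => ξ k i ω) n 0 0)
          (triangleSeq T₀ (fun k i => ξ k i ω) n 1 0)
          (triangleSeq T₀ (fun k i => ξ k i ω) n 2 0)) n ω - (0 : ℕ → Ω → ℝ) n ω‖} ≤
      ENNReal.ofReal (31 / 32) ^ n * (flatness T₀ / ENNReal.ofReal (√ε)) := by
    intro n
    calc _ ≤ P {ω | ENNReal.ofReal (√ε) ≤ flatness (triangleSeq T₀ (fun k i => ξ k i ω) n)} := by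
          apply measure_mono_ae
          filter_upwards [ae_signedArea_triangleSeq_ne_zero hT₀ hξ_unif] with ω hω hle
          by_contra hlt
          have := abs_normalizedX_sub_flatX_lt (hω n) hε0 hε hεδ (not_le.1 hlt)
          simp only [Pi.sub_apply, Pi.zero_apply, sub_zero, Real.norm_eq_abs]
            at hle
          exact absurd hle (not_le.2 this)
      _ ≤ (∫⁻ ω, flatness (triangleSeq T₀ (fun k i => ξ k i ω) n) ∂P) / ENNReal.ofReal (√ε) :=
          meas_ge_le_lintegral_div (measurable_flatness.comp_aemeasurable
            (aemeasurable_triangleSeq hξ_unif n)) hη (by simp)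
      _ ≤ _ := by
          rw [← mul_div_assoc]
          gcongr
          exact lintegral_flatness_triangleSeq_le hξ_indep hξ_unif n
  have hfin : flatness T₀ / ENNReal.ofReal (√ε) ≠ ⊤ :=
    ENNReal.div_ne_top (flatness_ne_top_of_flatWidth_pos
      (flatWidth_pos_of_signedArea_ne_zero hT₀)) hη
  have hlim : Tendsto (fun n : ℕ => ENNReal.ofReal (31 / 32) ^ n *
      (flatness T₀ / ENNReal.ofReal (√ε))) atTop (nhds 0) := by
    have := ENNReal.Tendsto.mul_const (b := flatness T₀ / ENNReal.ofReal (√ε))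
      (ENNReal.tendsto_pow_atTop_nhds_zero_of_lt_one
        (r := ENNReal.ofReal (31 / 32)) (by rw [ENNReal.ofReal_lt_one]; norm_num)) (Or.inr hfin)
    rwa [zero_mul] at this
  exact tendsto_of_tendsto_of_tendsto_of_le_of_le tendsto_const_nhds hlim
    (fun _ => zero_le) bound

/-- `normalizedX` is defined by choice, so measurability is inherited from the explicit formula in
the side lengths, which agrees with it almost surely. -/
lemma aemeasurable_normalizedX_triangleSeq (hT₀ : signedArea T₀ ≠ 0)
    (hξ_unif : ∀ n i, pdf.IsUniform (ξ n i) (Set.Icc 0 1) P volume) (n : ℕ) :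
    AEMeasurable (fun ω => normalizedX (triangleSeq T₀ (fun k i => ξ k i ω) n)) P := by
  have hd : Measurable fun T : Fin 3 → Plane =>
      (dist (T 1) (T 2), dist (T 2) (T 0), dist (T 0) (T 1)) := by
    fun_prop
  refine ((measurable_apexX.comp hd).comp_aemeasurable
    (aemeasurable_triangleSeq (T₀ := T₀) hξ_unif n)).congr ?_
  filter_upwards [ae_signedArea_triangleSeq_ne_zero hT₀ hξ_unif] with ω hω
  refine (normalizedX_eq_apexX ?_).symm
  by_contra hcon
  push Not at hcon
  apply hω n
  rw [signedArea, hcon 1 0, hcon 2 0]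
  ring

end RandomTriangles

theorem theorem5 {Ω Ω' : Type*} [MeasurableSpace Ω] [MeasurableSpace Ω']
    (P : Measure Ω) [IsProbabilityMeasure P] (P' : Measure Ω') [IsProbabilityMeasure P']
    (T₀ : Fin 3 → Plane) (hT₀ : AffineIndependent ℝ T₀)
    (ξ : ℕ → Fin 3 → Ω → ℝ)
    (hξ_indep : iIndepFun (fun p : ℕ × Fin 3 => ξ p.1 p.2) P)
    (hξ_unif : ∀ n i, pdf.IsUniform (ξ n i) (Set.Icc 0 1) P volume)
    (U : Ω' → ℝ) (hU : pdf.IsUniform U (Set.Icc (1 / 2) 1) P' volume) :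
    (∀ᵐ ω ∂P, ∀ n, AffineIndependent ℝ (triangleSeq T₀ (fun k i => ξ k i ω) n)) ∧
    TendstoInDistribution
      (fun n ω => normalizedX (triangleSeq T₀ (fun k i => ξ k i ω) n))
      atTop U (fun _ => P) P' := by
  have hA₀ := (affineIndependent_iff_signedArea_ne_zero T₀).1 hT₀
  refine ⟨?_, ?_⟩
  · filter_upwards [ae_signedArea_triangleSeq_ne_zero hA₀ hξ_unif] with ω hω n
    exact (affineIndependent_iff_signedArea_ne_zero _).2 (hω n)
  -- Slutsky's theorem, with the apex of the projection as the approximating sequence.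
  · refine tendstoInDistribution_of_tendstoInMeasure_sub _ U ⟨fun n => ?_, ?_, ?_⟩
      (tendstoInMeasure_normalizedX_sub_flatX hA₀ hξ_indep hξ_unif)
      (aemeasurable_normalizedX_triangleSeq hA₀ hξ_unif)
    · exact (aemeasurable_triangleSeq hξ_unif n).flatX
    · refine hU.aemeasurable ?_ ?_
      · rw [Real.volume_Icc]
        norm_num
      · simp
    -- The laws of the approximating sequence are constant from index `1` on; at index `0` the
    -- projected shape is that of `T₀`.
    · refine tendsto_const_nhds.congr' ?_
      filter_upwards [eventually_ge_atTop 1] with n hn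
      obtain ⟨m, rfl⟩ := Nat.exists_eq_succ_of_ne_zero (by omega : n ≠ 0)
      apply Subtype.ext
      exact hU.trans (map_flatX_triangleSeq_succ hA₀ hξ_indep hξ_unif m).symm
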